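/- **Theorem (generalized Borkar–Meyn theorem, distributed form).** Let $D\in\mathbb N$, $d=d_1+\dots+d_D$, and write $v=(v^1,\dots,v^D)\in\mathbb R^d=\mathbb R^{d_1}\times\dots\times\mathbb R^{d_D}$, with Euclidean norms. On a probability space let $(x_n)_{n\ge 0}$, $(M_{n+1})_{n\ge 1}$ be $\mathbb R^d$-valued random variables and $\tau_{ij}(n)$, $1\le i,j\le D$, $n\ge 1$, be random variables with values in $\{0,\dots,n\}$, such that for all $n\ge1$ and $1\le i\le D$ $$x^i_{n+1}=x^i_n+a(n)\Big[h^i\big(x^1_{n-\tau_{i1}(n)},\dots,x^D_{n-\tau_{iD}(n)}\big)+M^i_{n+1}\Big],$$ where the initial values satisfy $\mathbb E\|x_0\|^2<\infty$ and $\mathbb E\|x_1\|^2<\infty$. Assume: 1. (Lipschitz drift) $h=(h^1,\dots,h^D):\mathbb R^d\to\mathbb R^d$ is Lipschitz continuous. 2. (Noise) Let $\mathcal F_1=\sigma(x_0,x_1)$ and, for $n\ge2$, $\mathcal F_n=\sigma\big(x_0,x_1,M_2,\dots,M_n,\tau_{ij}(1),\dots,\tau_{ij}(n),\ 1\le i,j\le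 D\big)$. The $M_{n+1}$ are square integrable and there is $K>0$ such that, almost surely, for all $n\ge1$ and $1\le i\le D$, $$\mathbb E[M^i_{n+1}\mid\mathcal F_n]=0,\qquad \mathbb E\big[\|M^i_{n+1}\|^2\mid\mathcal F_n\big]\le K^2\Big(1+\big\|\big(x^1_{n-\tau_{i1}(n)},\dots,x^D_{n-\tau_{iD}(n)}\big)\big\|^2\Big).$$ 3. (Age of information) $\tau_{ij}(n+1)\le\tau_{ij}(n)+1$ for all $i,j$ and $n\ge1$, and there are $p>0$ and a non-negative random variable $\overline\tau$ (possibly on another probability space) with $\mathbb E[\overline\tau^{\,p}]<\infty$ and $\Pr(\tau_{ij}(n)>m)\le\Pr(\overline\tau>m)$ for all $m\ge0$, $n\ge1$ and $i,j$. 4. (Stepsize) For some $a_0>0$: if $p\le1$, then $a(n)=a_0/n$ for all $n\ge1$; if $p>1$, then $a(n)=a_0\,n^{-1/q}$ for all $n\ge1$, for some $q$ with $1<q<\min\{2,p\}$. 5. (Scaling limit along one sequence) There are a nondecreasing sequence $c_n\ge1$ with $c_n\to\infty$ and a continuous $h_\infty:\mathbb R^d\to\mathbb R^d$ such that $h(c_nx)/c_n\to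 h_\infty(x)$ for every $x\in\mathbb R^d$, and the origin is the (unique) globally asymptotically stable equilibrium of the ODE $\dot x(t)=h_\infty(x(t))$. Then $\sup_{n\ge0}\|x_n\|<\infty$ almost surely. -/

import Mathlib

open MeasureTheory Filter Topology
open scoped NNReal ENNReal

/-- The state space `ℝ^d = ℝ^{d₁} × ⋯ × ℝ^{d_D}`, `d = d₁ + ⋯ + d_D`, with its block structure and the
Euclidean norm. The `i`-th block of `v` is `v i`. -/
abbrev BlockSpace {D : ℕ} (d : Fin D → ℕ) : Type :=
  PiLp 2 (fun i : Fin D => EuclideanSpace ℝ (Fin (d i)))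

/-- `φ : [0, ∞) → E` solves the ODE `ẋ(t) = f(x(t))` (one-sided derivative at `t = 0`). -/
def IsODESolution {E : Type*} [NormedAddCommGroup E] [NormedSpace ℝ E]
    (f : E → E) (φ : ℝ → E) : Prop :=
  ∀ t : ℝ, 0 ≤ t → HasDerivWithinAt φ (f (φ t)) (Set.Ici 0) t

/-- The point `z` is a globally asymptotically stable equilibrium of `ẋ(t) = f(x(t))`: it is an
equilibrium, it is Lyapunov stable, and every solution converges to it. Such an equilibrium is
necessarily unique, as any other one would be a constant solution that does not converge to `z`. -/
structure IsGloballyAsymptoticallyStable {E : Type*} [NormedAddCommGroup E] [NormedSpace ℝ E]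
    (f : E → E) (z : E) : Prop where
  equilibrium : f z = 0
  stable : ∀ ε > 0, ∃ δ > 0, ∀ φ : ℝ → E, IsODESolution f φ → ‖φ 0 - z‖ < δ →
    ∀ t : ℝ, 0 ≤ t → ‖φ t - z‖ < ε
  attractive : ∀ φ : ℝ → E, IsODESolution f φ → Tendsto φ atTop (𝓝 z)

/-- The scaling condition: along some sequence `1 ≤ c_n ↗ ∞` the functions `h_{c_n}(x) = h(c_n x) / c_n`
converge pointwise to a continuous `h_∞`, and the origin is the globally asymptotically stable
equilibrium of `ẋ(t) = h_∞(x(t))`. -/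
def HasStableScalingLimit {E : Type*} [NormedAddCommGroup E] [NormedSpace ℝ E]
    (h : E → E) : Prop :=
  ∃ (c : ℕ → ℝ) (hInf : E → E),
    (∀ n, 1 ≤ c n) ∧ Monotone c ∧ Tendsto c atTop atTop ∧
    (∀ y, Tendsto (fun n => (c n)⁻¹ • h (c n • y)) atTop (𝓝 (hInf y))) ∧
    Continuous hInf ∧ IsGloballyAsymptoticallyStable hInf 0

/-- An age of information process `τ(n)`, `n ≥ 1`: it takes values in the non-negative integers, the
time stamp `n - τ(n)` of the information in use is at least `0`, and the age grows by at most one per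
step (equivalently, `n - τ(n)` is nondecreasing). -/
structure IsAoIProcess {Ω : Type*} [MeasurableSpace Ω] (τ : ℕ → Ω → ℕ) : Prop where
  measurable : ∀ n, 1 ≤ n → Measurable (τ n)
  age_le : ∀ n, 1 ≤ n → ∀ ω, τ n ω ≤ n
  unit_growth : ∀ n, 1 ≤ n → ∀ ω, τ (n + 1) ω ≤ τ n ω + 1

/-- `X` is stochastically dominated by `Y`: `P(X > m) ≤ P(Y > m)` for all `m ≥ 0`. The two random
variables may live on different probability spaces. -/
def StochDominated {Ω Ω' : Type*} [MeasurableSpace Ω] [MeasurableSpace Ω']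
    (P : Measure Ω) (X : Ω → ℝ) (Q : Measure Ω') (Y : Ω' → ℝ) : Prop :=
  ∀ m : ℝ, 0 ≤ m → P {ω | m < X ω} ≤ Q {ω | m < Y ω}

/-- The stepsize rule for the moment exponent `p`, with some `a₀ > 0`: `a(n) = a₀ / n` if `p ≤ 1`, and
`a(n) = a₀ n^{-1/q}` for some `1 < q < min {2, p}` if `p > 1`. -/
def IsStepsize (p : ℝ) (a : ℕ → ℝ) : Prop :=
  ∃ a₀ : ℝ, 0 < a₀ ∧
    (p ≤ 1 → ∀ n : ℕ, 1 ≤ n → a n = a₀ / (n : ℝ)) ∧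
    (1 < p → ∃ q : ℝ, 1 < q ∧ q < min 2 p ∧ ∀ n : ℕ, 1 ≤ n → a n = a₀ * (n : ℝ) ^ (-1 / q))

/-- The aged state used by component `i` at time `n`:
`(x¹_{n - τ_{i1}(n)}, …, x^D_{n - τ_{iD}(n)})`. -/
def agedState {Ω : Type*} {D : ℕ} {d : Fin D → ℕ} (x : ℕ → Ω → BlockSpace d)
    (τ : Fin D → Fin D → ℕ → Ω → ℕ) (i : Fin D) (n : ℕ) (ω : Ω) : BlockSpace d :=
  WithLp.toLp 2 (fun j => x (n - τ i j n ω) ω j)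

/-- The history `σ`-algebras: `𝓕₁` is generated by the initial values `x_0, x_1`, and `𝓕_n`, `n ≥ 2`, by
the initial values, `M_2, …, M_n` and all `τ_{ij}(1), …, τ_{ij}(n)`. -/
@[reducible] def history {Ω : Type*} {D : ℕ} {d : Fin D → ℕ} (x M : ℕ → Ω → BlockSpace d)
    (τ : Fin D → Fin D → ℕ → Ω → ℕ) (n : ℕ) : MeasurableSpace Ω :=
  MeasurableSpace.comap (x 0) inferInstance ⊔ MeasurableSpace.comap (x 1) inferInstance ⊔
    (⨆ k ∈ Set.Icc 2 n, MeasurableSpace.comap (M k) inferInstance) ⊔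
    (⨆ (_ : 2 ≤ n), ⨆ k ∈ Set.Icc 1 n, ⨆ (i : Fin D), ⨆ (j : Fin D),
      MeasurableSpace.comap (τ i j k) inferInstance)

/-- The distributed stochastic approximation iteration, for `n ≥ 1` and every component `i`:
`x^i_{n+1} = x^i_n + a(n) [h^i(x¹_{n - τ_{i1}(n)}, …, x^D_{n - τ_{iD}(n)}) + M^i_{n+1}]`. -/
def IsDistributedSA {Ω : Type*} {D : ℕ} {d : Fin D → ℕ} (h : BlockSpace d → BlockSpace d)
    (a : ℕ → ℝ) (τ : Fin D → Fin D → ℕ → Ω → ℕ) (x M : ℕ → Ω → BlockSpace d) : Prop :=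
  ∀ n, 1 ≤ n → ∀ ω i,
    x (n + 1) ω i = x n ω i + a n • (h (agedState x τ i n ω) i + M (n + 1) ω i)

/-- The noise condition, with constant `K`: the `M_{n+1}`, `n ≥ 1`, are square integrable martingale
differences for the history, and the conditional second moment of each component is bounded through
the aged state that this component uses. -/
structure IsNoise {Ω : Type*} [MeasurableSpace Ω] (P : Measure Ω) {D : ℕ} {d : Fin D → ℕ}
    (τ : Fin D → Fin D → ℕ → Ω → ℕ) (x M : ℕ → Ω → BlockSpace d) (K : ℝ) : Prop where
  measurable : ∀ n, 1 ≤ n → Measurable (M (n + 1))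
  memLp : ∀ n, 1 ≤ n → MemLp (M (n + 1)) 2 P
  condExp_eq_zero : ∀ n, 1 ≤ n → ∀ i : Fin D,
    P[fun ω => M (n + 1) ω i | history x M τ n] =ᵐ[P] 0
  condExp_sq_le : ∀ n, 1 ≤ n → ∀ i : Fin D,
    P[fun ω => ‖M (n + 1) ω i‖ ^ 2 | history x M τ n] ≤ᵐ[P]
      fun ω => K ^ 2 * (1 + ‖agedState x τ i n ω‖ ^ 2)

/-! ### The limiting ODE and its perturbed Euler schemes -/

section ODE

variable {E : Type*} [NormedAddCommGroup E] [NormedSpace ℝ E]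

/-! Divide the iterates by one large scale `c` of the given sequence and start at a late time `n₀`.
While the rescaled path stays in the unit ball it is an Euler scheme for the limit ODE with three
small errors: the scaling error, the effect of the ages, and the noise. Stability makes such a
scheme self-confining (`exists_perturbed_euler_margin`): if it starts within `δ` of the origin and
the errors are at most `η`, it never leaves the unit ball. The path is then bounded by `c` forever,
so no comparison between different scales is needed.

The errors are controlled as follows. The rescaled drifts share one Lipschitz constant, so they
converge uniformly on the unit ball. Moments of the dominating variable and unit growth of the ages
make the stepsize mass of every age window eventually small (`ae_eventually_sum_stepsize_le`), and
over a window the path moves little. The noise is switched off outside the ball of radius `c`; its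
rescaled variance is then at most a constant times `a(n)²`, uniformly in `c ≥ 1`, and a maximal
inequality bounds all partial sums at once.

Unboundedness thus forces a bad age window after `n₀`, a large noise sum after `n₀`, or an initial
segment up to `n₀` exceeding `ε c`. Letting `c → ∞` with `n₀` fixed removes the third event; `n₀ →
∞` then removes the first two. -/

theorem exists_hasDerivWithinAt_Icc_of_lipschitzWith [CompleteSpace E] {f : E → E} {L : ℝ≥0}
    (hf : LipschitzWith L f) {r : ℝ} (hr : 0 < r) (hr' : (L + 1) * r ≤ 1) (z : E) :
    ∃ α : ℝ → E, α 0 = z ∧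
      ∀ t ∈ Set.Icc 0 r, HasDerivWithinAt α (f (α t)) (Set.Icc 0 r) t := by
  have hb : ∀ y ∈ Metric.closedBall z (‖f z‖₊ + 1 : ℝ≥0),
      ‖f y‖ ≤ ((L + 1) * (‖f z‖₊ + 1) : ℝ≥0) := by
    intro y hy
    have h1 : ‖f y - f z‖ ≤ L * ‖y - z‖ := hf.norm_sub_le y z
    have h2 : ‖y - z‖ ≤ ‖f z‖ + 1 := by simpa [dist_eq_norm] using hy
    have h3 : ‖f y‖ ≤ ‖f y - f z‖ + ‖f z‖ := by simpa using norm_add_le (f y - f z) (f z)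
    have h4 : (L : ℝ) * ‖y - z‖ ≤ L * (‖f z‖ + 1) := by gcongr
    push_cast
    linarith
  -- The radius `‖f z‖ + 1` grows with `z`, so that radius over speed is `1 / (L + 1)`, an existence
  -- time independent of `z`.
  have hP : IsPicardLindelof (fun _ => f) (tmin := 0) (tmax := r) ⟨0, by simp [hr.le]⟩ z
      (‖f z‖₊ + 1) 0 ((L + 1) * (‖f z‖₊ + 1)) L := by
    refine ⟨fun t _ => hf.lipschitzOnWith, fun y _ => continuousOn_const, fun t _ y hy => hb y hy, ?_⟩
    simp only [sub_zero, sub_self, max_eq_left hr.le]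
    push_cast
    simp only [sub_zero]
    have : 0 ≤ ‖f z‖ + 1 := by positivity
    nlinarith
  obtain ⟨α, h0, hα⟩ := hP.exists_eq_forall_mem_Icc_hasDerivWithinAt₀
  exact ⟨α, h0, hα⟩

/-- Local solutions exist on intervals of one common length `r`, so they can be chained over the
nodes `r * k`. -/
theorem exists_isODESolution [CompleteSpace E] {f : E → E} {L : ℝ≥0}
    (hf : LipschitzWith L f) (z : E) : ∃ φ : ℝ → E, IsODESolution f φ ∧ φ 0 = z := by
  obtain ⟨r, hr, hr'⟩ : ∃ r : ℝ, 0 < r ∧ (L + 1) * r ≤ 1 :=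
    ⟨(L + 1)⁻¹, by positivity, by rw [mul_inv_cancel₀]; positivity⟩
  choose α hα0 hα using exists_hasDerivWithinAt_Icc_of_lipschitzWith hf hr hr'
  set node : ℕ → E := fun k => Nat.rec z (fun _ y => α y r) k with hnode
  have hnode_succ : ∀ k, node (k + 1) = α (node k) r := fun k => rfl
  set φ : ℝ → E := fun t => α (node ⌊t / r⌋₊) (t - r * ⌊t / r⌋₊) with hφ
  have hφ_piece : ∀ k : ℕ, ∀ t ∈ Set.Icc (r * k) (r * k + r), φ t = α (node k) (t - r * k) := by
    intro k t ht
    rcases ht.2.eq_or_lt with h | h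
    · have hfl : ⌊t / r⌋₊ = k + 1 := by
        rw [h, show (r * k + r) / r = ((k + 1 : ℕ) : ℝ) by push_cast; field_simp]
        exact Nat.floor_natCast _
      simp only [hφ, hfl, hnode_succ]
      rw [h]
      push_cast
      rw [show r * (k : ℝ) + r - r * (k + 1) = 0 by ring, hα0,
        show r * (k : ℝ) + r - r * k = r by ring]
    · have hfl : ⌊t / r⌋₊ = k := by
        rw [Nat.floor_eq_iff (div_nonneg (le_trans (by positivity) ht.1) hr.le)]
        rw [le_div_iff₀ hr, div_lt_iff₀ hr]
        exact ⟨by linarith [ht.1], by linarith⟩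
      simp only [hφ, hfl]
  have hpiece : ∀ k : ℕ, ∀ t ∈ Set.Icc (r * k) (r * k + r),
      HasDerivWithinAt φ (f (φ t)) (Set.Icc (r * k) (r * k + r)) t := by
    intro k t ht
    have h1 : HasDerivWithinAt (fun s => α (node k) (s - r * k)) (f (φ t))
        (Set.Icc (r * k) (r * k + r)) t := by
      have h2 := hα (node k) (t - r * k) ⟨by linarith [ht.1], by linarith [ht.2]⟩
      rw [← hφ_piece k t ht] at h2
      have h3 : HasDerivWithinAt (fun s : ℝ => s - r * k) 1 (Set.Icc (r * k) (r * k + r)) t :=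
        (hasDerivWithinAt_id _ _).sub_const _
      have h4 := HasDerivWithinAt.scomp (t' := Set.Icc 0 r) t h2 h3 (fun s hs => ⟨by linarith [hs.1], by linarith [hs.2]⟩)
      simpa using! h4
    exact h1.congr (hφ_piece k) (hφ_piece k t ht)
  refine ⟨φ, fun t ht => ?_, ?_⟩
  · set k := ⌊t / r⌋₊ with hk
    have hk1 : r * k ≤ t := by
      have := Nat.floor_le (div_nonneg ht hr.le)
      rw [le_div_iff₀ hr] at this; linarith
    have hk2 : t < r * k + r := by
      have := Nat.lt_floor_add_one (t / r)
      rw [div_lt_iff₀ hr] at this; linarith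
    -- At a positive node the derivative is glued from the two adjacent pieces; at time `0` only the
    -- right side is required.
    rcases hk1.eq_or_lt with h | h
    · rcases Nat.eq_zero_or_eq_succ_pred k with h0 | h0
      · have h1 := hpiece k t ⟨hk1, hk2.le⟩
        refine h1.mono_of_mem_nhdsWithin ?_
        have ht0 : t = 0 := by rw [← h, h0]; simp
        rw [h0, ht0]
        simpa using Icc_mem_nhdsGE hr
      · obtain ⟨m, hm⟩ : ∃ m, k = m + 1 := ⟨_, h0⟩
        have hmt : t = r * m + r := by rw [← h, hm]; push_cast; ring
        have h1 := (hpiece m t ⟨by linarith, hmt.le⟩).union (hpiece k t ⟨hk1, hk2.le⟩)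
        refine h1.mono_of_mem_nhdsWithin (mem_nhdsWithin_of_mem_nhds ?_)
        rw [← hmt, ← h, Set.Icc_union_Icc_eq_Icc (by linarith) (by linarith), h]
        exact Icc_mem_nhds (by linarith) (by linarith)
    · exact (hpiece k t ⟨hk1, hk2.le⟩).mono_of_mem_nhdsWithin
        (mem_nhdsWithin_of_mem_nhds (Icc_mem_nhds h hk2))
  · have := hφ_piece 0 0 (by simp [hr.le])
    rw [this]
    simp [hα0, hnode]

theorem IsODESolution.shift {f : E → E} {φ : ℝ → E} (hφ : IsODESolution f φ) {s : ℝ}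
    (hs : 0 ≤ s) : IsODESolution f fun t => φ (s + t) := by
  intro t ht
  have h := HasDerivWithinAt.scomp (t' := Set.Ici 0) t (hφ (s + t) (by positivity))
    ((hasDerivWithinAt_id t (Set.Ici 0)).const_add s) (fun u hu => add_nonneg hs hu)
  simpa using! h

theorem IsODESolution.dist_le {f : E → E} {L : ℝ≥0} (hf : LipschitzWith L f) {φ ψ : ℝ → E}
    (hφ : IsODESolution f φ) (hψ : IsODESolution f ψ) {t : ℝ} (ht : 0 ≤ t) :
    dist (φ t) (ψ t) ≤ dist (φ 0) (ψ 0) * Real.exp (L * t) := by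
  have hc : ∀ {χ : ℝ → E}, IsODESolution f χ → ContinuousOn χ (Set.Icc 0 t) := fun hχ s hs =>
    ((hχ s hs.1).continuousWithinAt).mono Set.Icc_subset_Ici_self
  have hd : ∀ {χ : ℝ → E}, IsODESolution f χ → ∀ s ∈ Set.Ico 0 t,
      HasDerivWithinAt χ (f (χ s)) (Set.Ici s) s := fun hχ s hs =>
    (hχ s hs.1).mono (Set.Ici_subset_Ici.2 hs.1)
  have := dist_le_of_trajectories_ODE (v := fun _ => f) (fun _ => hf) (hc hφ) (hd hφ) (hc hψ)
    (hd hψ) le_rfl t ⟨ht, le_rfl⟩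
  simpa using this

/-- The solution from `z` enters the stability neighbourhood at some time; by Grönwall so do its
neighbours at that time, and stability keeps them small afterwards. Compactness leaves finitely many
times, whose sum dominates each. -/
theorem IsGloballyAsymptoticallyStable.uniform_attraction [ProperSpace E] {f : E → E} {L : ℝ≥0}
    (hf : LipschitzWith L f) (hs : IsGloballyAsymptoticallyStable f 0) (R : ℝ) {ε : ℝ}
    (hε : 0 < ε) : ∃ T : ℝ, 0 ≤ T ∧ ∀ φ : ℝ → E, IsODESolution f φ → ‖φ 0‖ ≤ R →
      ∀ t, T ≤ t → ‖φ t‖ < ε := by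
  obtain ⟨δ, hδ, hstab⟩ := hs.stable ε hε
  have hloc : ∀ z : E, ∃ T : ℝ, ∃ ρ > 0, 0 ≤ T ∧ ∀ φ : ℝ → E, IsODESolution f φ →
      dist (φ 0) z < ρ → ∀ t, T ≤ t → ‖φ t‖ < ε := by
    intro z
    obtain ⟨ψ, hψ, hψ0⟩ := exists_isODESolution hf z
    obtain ⟨T, hT, hT0⟩ : ∃ T, ‖ψ T‖ < δ / 2 ∧ 0 ≤ T := by
      have h1 := (hs.attractive ψ hψ).norm
      rw [norm_zero] at h1
      exact ((h1.eventually_lt_const (half_pos hδ)).and (eventually_ge_atTop 0)).exists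
    refine ⟨T, δ / 2 * Real.exp (-(L * T)), by positivity, hT0, fun φ hφ hd t ht => ?_⟩
    have h2 : dist (φ T) (ψ T) < δ / 2 := by
      refine (hφ.dist_le hf hψ hT0).trans_lt ?_
      rw [hψ0]
      calc dist (φ 0) z * Real.exp (L * T)
          < δ / 2 * Real.exp (-(L * T)) * Real.exp (L * T) := by gcongr
        _ = δ / 2 := by rw [mul_assoc, ← Real.exp_add]; simp
    have h3 : ‖φ T‖ < δ := by
      have : ‖φ T‖ ≤ dist (φ T) (ψ T) + ‖ψ T‖ := by
        rw [dist_eq_norm]; simpa using norm_add_le (φ T - ψ T) (ψ T)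
      linarith
    have h4 := hstab _ (hφ.shift hT0) (by simpa using h3) (t - T) (by linarith)
    simpa using h4
  choose T ρ hρ hT hloc using hloc
  obtain ⟨s, -, hs⟩ := (isCompact_closedBall (0 : E) R).elim_nhds_subcover
    (fun z => Metric.ball z (ρ z)) (fun z _ => Metric.ball_mem_nhds z (hρ z))
  refine ⟨∑ z ∈ s, T z, Finset.sum_nonneg fun z _ => hT z, fun φ hφ h0 t ht => ?_⟩
  have hmem := hs (show φ 0 ∈ Metric.closedBall (0 : E) R by simpa using h0)
  simp only [Set.mem_iUnion, Metric.mem_ball, exists_prop] at hmem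
  obtain ⟨z, hz, hd⟩ := hmem
  exact hloc z φ hφ hd t ((Finset.single_le_sum (fun z _ => hT z) hz).trans ht)

/-- On the unit ball the speed is at most `L`, so `f` along the solution varies by at most `L * (L *
b)` during a step of length `b`. -/
theorem IsODESolution.norm_step_sub_le {f : E → E} {L : ℝ≥0} (hf : LipschitzWith L f)
    (hf0 : f 0 = 0) {φ : ℝ → E} (hφ : IsODESolution f φ) (hb : ∀ t, 0 ≤ t → ‖φ t‖ ≤ 1)
    {t b : ℝ} (ht : 0 ≤ t) (hbn : 0 ≤ b) :
    ‖φ (t + b) - φ t - b • f (φ t)‖ ≤ L ^ 2 * b ^ 2 := by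
  have hfb : ∀ s, 0 ≤ s → ‖f (φ s)‖ ≤ L := fun s hs => by
    have := hf.norm_sub_le (φ s) 0
    rw [hf0, sub_zero, sub_zero] at this
    exact this.trans (mul_le_of_le_one_right L.2 (hb s hs))
  have hsub : Set.Icc t (t + b) ⊆ Set.Ici 0 := fun s hs => ht.trans hs.1
  have h1 : ∀ s ∈ Set.Icc t (t + b), ‖φ s - φ t‖ ≤ L * b := fun s hs => by
    refine ((convex_Icc t (t + b)).norm_image_sub_le_of_norm_hasDerivWithin_le
      (fun u hu => (hφ u (hsub hu)).mono hsub) (fun u hu => hfb u (hsub hu))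
      ⟨le_rfl, by linarith⟩ hs).trans ?_
    rw [Real.norm_of_nonneg (by linarith [hs.1])]
    have := hs.2
    gcongr
    linarith
  have h2 := (convex_Icc t (t + b)).norm_image_sub_le_of_norm_hasDerivWithin_le
    (f := fun s => φ s - s • f (φ t)) (f' := fun s => f (φ s) - (1 : ℝ) • f (φ t)) (C := L * (L * b))
    (fun u hu => ((hφ u (hsub hu)).mono hsub).sub ((hasDerivWithinAt_id u _).smul_const _))
    (fun u hu => by
      rw [one_smul]
      exact (hf.norm_sub_le _ _).trans (mul_le_mul_of_nonneg_left (h1 u hu) L.2))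
    (x := t) (y := t + b) ⟨le_rfl, by linarith⟩ ⟨by linarith, le_rfl⟩
  calc ‖φ (t + b) - φ t - b • f (φ t)‖
      = ‖φ (t + b) - (t + b) • f (φ t) - (φ t - t • f (φ t))‖ := by
        congr 1; rw [add_smul]; abel
    _ ≤ L * (L * b) * ‖t + b - t‖ := h2
    _ = L ^ 2 * b ^ 2 := by rw [add_sub_cancel_left, Real.norm_of_nonneg hbn]; ring

/-- Euler approximation of a bounded solution with perturbations of size `η`. -/
theorem IsODESolution.norm_perturbed_euler_sub_le {f : E → E} {L : ℝ≥0} (hf : LipschitzWith L f)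
    (hf0 : f 0 = 0) {φ : ℝ → E} (hφ : IsODESolution f φ) (hb : ∀ t, 0 ≤ t → ‖φ t‖ ≤ 1)
    {η : ℝ} {y ζ : ℕ → E} {a : ℕ → ℝ} (ha : ∀ n, 0 ≤ a n) (ha' : ∀ n, a n ≤ η)
    (hy0 : y 0 = φ 0) (hζ : ∀ n, ‖ζ n‖ ≤ η) (k : ℕ)
    (hy : ∀ n < k, ∃ e, ‖e‖ ≤ η ∧ y (n + 1) = y n + a n • (f (y n) + e) + (ζ (n + 1) - ζ n)) :
    ‖y k - φ (∑ m ∈ Finset.range k, a m)‖ ≤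
      η * ((L + 1) ^ 2 * Real.exp ((L + 1) * ∑ m ∈ Finset.range k, a m) + 2) := by
  have hη : 0 ≤ η := (ha 0).trans (ha' 0)
  set t : ℕ → ℝ := fun k => ∑ m ∈ Finset.range k, a m with ht
  have ht0 : ∀ k, 0 ≤ t k := fun k => Finset.sum_nonneg fun m _ => ha m
  have hts : ∀ k, t (k + 1) = t k + a k := fun k => Finset.sum_range_succ _ _
  -- Subtracting the accumulated noise telescopes it away: `z` obeys an Euler recursion without `ζ`,
  -- at the price `2 * η`.
  set z : ℕ → E := fun k => y k - ζ k + ζ 0 with hz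
  have hzy : ∀ k, ‖y k - z k‖ ≤ 2 * η := fun k => by
    have : y k - z k = ζ k - ζ 0 := by simp only [hz]; abel
    rw [this]
    linarith [norm_sub_le (ζ k) (ζ 0), hζ k, hζ 0]
  have key : ∀ n ≤ k, ‖z n - φ (t n)‖ ≤ (L + 1) ^ 2 * η * (Real.exp ((L + 1) * t n) - 1) := by
    intro n
    induction n with
    | zero => intro _; simp [hz, ht, hy0]
    | succ n ih =>
      intro hn
      specialize ih (by omega)
      obtain ⟨e, he, hyn⟩ := hy n (by omega)
      have hstep := hφ.norm_step_sub_le hf hf0 hb (ht0 n) (ha n)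
      have hzs : z (n + 1) - φ (t (n + 1)) = (z n - φ (t n)) + a n • (f (y n) - f (φ (t n)))
          + a n • e - (φ (t n + a n) - φ (t n) - a n • f (φ (t n))) := by
        simp only [hz, hts, hyn, smul_add, smul_sub]
        abel
      have hlip : ‖f (y n) - f (φ (t n))‖ ≤ L * (‖z n - φ (t n)‖ + 2 * η) := by
        refine (hf.norm_sub_le _ _).trans (mul_le_mul_of_nonneg_left ?_ L.2)
        have : y n - φ (t n) = (z n - φ (t n)) + (y n - z n) := by abel
        rw [this]
        exact (norm_add_le _ _).trans (by linarith [hzy n])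
      set w := ‖z n - φ (t n)‖ with hw
      have hw0 : 0 ≤ w := norm_nonneg _
      have h1 : ‖z (n + 1) - φ (t (n + 1))‖ ≤
          w + a n * (L * (w + 2 * η)) + a n * η + L ^ 2 * a n ^ 2 := by
        rw [hzs]
        refine (norm_sub_le _ _).trans (add_le_add ((norm_add_le _ _).trans (add_le_add
          ((norm_add_le _ _).trans (add_le_add le_rfl ?_)) ?_)) hstep)
        · rw [norm_smul, Real.norm_of_nonneg (ha n)]
          exact mul_le_mul_of_nonneg_left hlip (ha n)
        · rw [norm_smul, Real.norm_of_nonneg (ha n)]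
          exact mul_le_mul_of_nonneg_left he (ha n)
      have hL : (0 : ℝ) ≤ L := L.2
      have h2 : (L : ℝ) ^ 2 * a n ^ 2 ≤ L ^ 2 * (a n * η) := by
        have := mul_le_mul_of_nonneg_left (ha' n) (ha n)
        rw [sq (a n)]
        gcongr
      -- The error terms `2 * L * η`, `η` and `L ^ 2 * η` add up to `(L + 1) ^ 2 * η`. The rate `L +
      -- 1 ≥ 1` avoids a division by `L` in the Grönwall bound.
      have h3 : ‖z (n + 1) - φ (t (n + 1))‖ ≤
          (1 + (L + 1) * a n) * w + a n * ((L + 1) ^ 2 * η) := by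
        have := mul_nonneg (ha n) hw0
        nlinarith
      set B := (L + 1 : ℝ) ^ 2 * η with hB
      have hB0 : 0 ≤ B := by positivity
      set X := Real.exp ((L + 1) * t n)
      have hX : 0 ≤ X := (Real.exp_pos _).le
      have h4 : (1 + (L + 1) * a n) * X ≤ Real.exp ((L + 1) * t (n + 1)) := by
        rw [hts, mul_add, Real.exp_add, mul_comm]
        exact mul_le_mul_of_nonneg_left (by linarith [Real.add_one_le_exp ((L + 1) * a n)]) hX
      have h5 : (1 + (L + 1) * a n) * w ≤ (1 + (L + 1) * a n) * (B * (X - 1)) :=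
        mul_le_mul_of_nonneg_left ih (by have := ha n; positivity)
      have h6 := mul_le_mul_of_nonneg_left h4 hB0
      have h7 : 0 ≤ B * (L * a n) := by have := ha n; positivity
      nlinarith
  have h := key k le_rfl
  have h1 : y k - φ (t k) = (z k - φ (t k)) + (y k - z k) := by abel
  have h2 : ‖y k - φ (t k)‖ ≤ ‖z k - φ (t k)‖ + 2 * η := by
    rw [h1]; exact (norm_add_le _ _).trans (by linarith [hzy k])
  have h3 : 0 ≤ (L + 1 : ℝ) ^ 2 * η := by positivity
  change ‖y k - φ (t k)‖ ≤ η * ((L + 1) ^ 2 * Real.exp ((L + 1) * t k) + 2)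
  nlinarith

/-- If the origin is globally asymptotically stable for `ẋ = f(x)`, then every slightly perturbed
Euler scheme that starts close to the origin remains in the unit ball. -/
theorem IsGloballyAsymptoticallyStable.exists_perturbed_euler_margin [ProperSpace E] {f : E → E}
    {L : ℝ≥0} (hf : LipschitzWith L f) (hs : IsGloballyAsymptoticallyStable f 0) :
    ∃ δ > 0, ∃ η > 0, ∀ (y ζ : ℕ → E) (a : ℕ → ℝ), (∀ n, 0 ≤ a n) → (∀ n, a n ≤ η) →
      ‖y 0‖ ≤ δ → (∀ n, ‖ζ n‖ ≤ η) →
      (∀ n, (∀ m ≤ n, ‖y m‖ ≤ 1) → ∃ e, ‖e‖ ≤ η ∧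
        y (n + 1) = y n + a n • (f (y n) + e) + (ζ (n + 1) - ζ n)) →
      ∀ n, ‖y n‖ ≤ 1 := by
  obtain ⟨δ₀, hδ₀, hstab⟩ := hs.stable (1 / 2) (by norm_num)
  set δ := min (δ₀ / 2) 1 with hδdef
  have hδ : 0 < δ := by positivity
  have hδ1 : δ ≤ 1 := min_le_right _ _
  have hδδ₀ : δ < δ₀ := (min_le_left _ _).trans_lt (by linarith)
  obtain ⟨T, hT0, hT⟩ := hs.uniform_attraction hf δ (half_pos hδ)
  -- The horizon is `T + 1` because the last step may overshoot `T` by at most `η ≤ 1`.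
  set C := (L + 1 : ℝ) ^ 2 * Real.exp ((L + 1) * (T + 1)) + 2 with hC
  have hC0 : 0 < C := by positivity
  set η := min 1 (δ / 2 / C) with hη
  have hηC : η * C ≤ δ / 2 := by
    rw [← le_div_iff₀ hC0]; exact min_le_right _ _
  refine ⟨δ, hδ, η, by positivity, fun y ζ a ha ha' hy0 hζ hy => ?_⟩
  -- Invariant: `s` is the last restart, with `‖y s‖ ≤ δ`, and at most `T` units of time have
  -- elapsed since. Before `T` the norm is at most `1 / 2 + δ / 2`. Once `T` is passed the ODE
  -- solution is below `δ / 2`, the Euler error is at most `δ / 2`, and the scheme restarts.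
  suffices H : ∀ n, (∀ m ≤ n, ‖y m‖ ≤ 1) ∧ ∃ s k, n = s + k ∧ ‖y s‖ ≤ δ ∧
      ∑ m ∈ Finset.range k, a (s + m) ≤ T from fun n => (H n).1 n le_rfl
  intro n
  induction n with
  | zero =>
    refine ⟨fun m hm => ?_, 0, 0, rfl, hy0, by simpa using hT0⟩
    rw [Nat.le_zero.1 hm]; exact hy0.trans hδ1
  | succ n ih =>
    obtain ⟨hle, s, k, rfl, hys, hsum⟩ := ih
    obtain ⟨φ, hφ, hφ0⟩ := exists_isODESolution hf (y s)
    have hφb : ∀ t, 0 ≤ t → ‖φ t‖ < 1 / 2 := fun t ht => by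
      simpa using hstab φ hφ (by rw [hφ0, sub_zero]; exact hys.trans_lt hδδ₀) t ht
    have herr := hφ.norm_perturbed_euler_sub_le hf hs.equilibrium
      (fun t ht => (hφb t ht).le.trans (by norm_num)) (y := fun n => y (s + n))
      (ζ := fun n => ζ (s + n)) (a := fun n => a (s + n)) (fun n => ha _) (fun n => ha' _)
      hφ0.symm (fun n => hζ _) (k + 1) (fun n hn => hy (s + n) fun m hm => hle m (by omega))
    set t := ∑ m ∈ Finset.range (k + 1), a (s + m) with ht
    have ht0 : 0 ≤ t := Finset.sum_nonneg fun m _ => ha _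
    have htT : t ≤ T + 1 := by
      rw [ht, Finset.sum_range_succ]
      exact add_le_add hsum ((ha' _).trans (min_le_left _ _))
    have herr' : ‖y (s + (k + 1)) - φ t‖ ≤ δ / 2 := by
      refine herr.trans (le_trans ?_ hηC)
      have hη0 : 0 ≤ η := by positivity
      rw [hC]
      gcongr
    have hyle : ‖y (s + (k + 1))‖ ≤ ‖φ t‖ + δ / 2 := by
      have := norm_add_le (y (s + (k + 1)) - φ t) (φ t)
      rw [sub_add_cancel] at this
      linarith
    refine ⟨fun m hm => ?_, ?_⟩
    · rcases hm.lt_or_eq with h | rfl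
      · exact hle m (by omega)
      · have := hφb t ht0
        rw [add_assoc]
        linarith
    · by_cases htT' : t ≤ T
      · exact ⟨s, k + 1, by omega, hys, htT'⟩
      · refine ⟨s + (k + 1), 0, by omega, ?_, by simpa using hT0⟩
        have := hT φ hφ (by rw [hφ0]; exact hys) t (not_le.1 htT').le
        linarith

end ODE

/-! ### Ages of information measured in stepsize time -/

section Delay

/-- The event says `n < (Y / ε) ^ q`, so the series is the tail sum of an integrable variable. -/
theorem tsum_measure_gt_rpow_lt_top {Ω' : Type*} [MeasurableSpace Ω'] (Q : Measure Ω')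
    [IsProbabilityMeasure Q] {Y : Ω' → ℝ} (hY : Measurable Y) (hY0 : ∀ ω, 0 ≤ Y ω)
    {p q : ℝ} (hq : 0 < q) (hqp : q ≤ p) (hint : Integrable (fun ω => Y ω ^ p) Q)
    {ε : ℝ} (hε : 0 < ε) :
    ∑' n : ℕ, Q {ω | ε * (n : ℝ) ^ (1 / q) < Y ω} < ∞ := by
  have hint' : Integrable (fun ω => (Y ω / ε) ^ q) Q := by
    have h1 : Integrable (fun ω => (1 + Y ω ^ p) / ε ^ q) Q :=
      ((integrable_const 1).add hint).div_const _
    refine h1.mono' ((hY.div_const ε).pow_const q).aestronglyMeasurable (ae_of_all _ fun ω => ?_)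
    rw [Real.norm_of_nonneg (Real.rpow_nonneg (div_nonneg (hY0 ω) hε.le) _),
      Real.div_rpow (hY0 ω) hε.le]
    gcongr
    rcases le_total (Y ω) 1 with h | h
    · have := Real.rpow_le_one (hY0 ω) h hq.le
      have := Real.rpow_nonneg (hY0 ω) p
      linarith
    · have := Real.rpow_le_rpow_of_exponent_le h hqp
      linarith
  let _ : MeasureSpace Ω' := ⟨Q⟩
  have : IsProbabilityMeasure (volume : Measure Ω') := ‹IsProbabilityMeasure Q›
  have h := ProbabilityTheory.tsum_prob_mem_Ioi_lt_top hint'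
    (fun ω => Real.rpow_nonneg (div_nonneg (hY0 ω) hε.le) _)
  refine lt_of_eq_of_lt (tsum_congr fun n => congrArg Q ?_) h
  ext ω
  simp only [Set.mem_ofPred_eq, Set.mem_Ioi]
  rw [← Real.rpow_lt_rpow_iff (z := q) (by positivity) (hY0 ω) hq,
    Real.mul_rpow hε.le (by positivity), ← Real.rpow_mul (by positivity), one_div_mul_cancel hq.ne',
    Real.rpow_one, Real.div_rpow (hY0 ω) hε.le, lt_div_iff₀ (by positivity), mul_comm]

theorem measure_gt_le_integral_rpow_div {Ω' : Type*} [MeasurableSpace Ω'] (Q : Measure Ω')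
    [IsProbabilityMeasure Q] {Y : Ω' → ℝ} (hY0 : ∀ ω, 0 ≤ Y ω) {p : ℝ} (hp : 0 < p)
    (hint : Integrable (fun ω => Y ω ^ p) Q) {s : ℝ} (hs : 0 < s) :
    Q {ω | s < Y ω} ≤ ENNReal.ofReal ((∫ ω, Y ω ^ p ∂Q) / s ^ p) := by
  have h1 := mul_meas_ge_le_integral_of_nonneg
    (ae_of_all Q fun ω => Real.rpow_nonneg (hY0 ω) p) hint (s ^ p)
  rw [← ofReal_measureReal]
  refine ENNReal.ofReal_le_ofReal ?_
  rw [le_div_iff₀ (by positivity), mul_comm]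
  refine le_trans (mul_le_mul_of_nonneg_left (measureReal_mono fun ω hω => ?_) (by positivity)) h1
  exact Real.rpow_le_rpow hs.le (le_of_lt hω) hp.le

variable {Ω Ω' : Type*} [MeasurableSpace Ω] [MeasurableSpace Ω'] {P : Measure Ω}
  {Q : Measure Ω'} [IsProbabilityMeasure Q] {τ : ℕ → Ω → ℕ}
  {τbar : Ω' → ℝ} {p : ℝ}

theorem ae_eventually_age_le_mul_rpow
    (hτbar : Measurable τbar) (hτbar_nonneg : ∀ ω, 0 ≤ τbar ω)
    (hmom : Integrable (fun ω => τbar ω ^ p) Q)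
    (hdom : ∀ n : ℕ, 1 ≤ n → StochDominated P (fun ω => (τ n ω : ℝ)) Q τbar)
    {q : ℝ} (hq : 0 < q) (hqp : q ≤ p) {ε : ℝ} (hε : 0 < ε) :
    ∀ᵐ ω ∂P, ∀ᶠ n : ℕ in atTop, (τ n ω : ℝ) ≤ ε * (n : ℝ) ^ (1 / q) := by
  have h1 := tsum_measure_gt_rpow_lt_top Q hτbar hτbar_nonneg hq hqp hmom hε
  have h2 : ∑' n : ℕ, P {ω | 1 ≤ n ∧ ε * (n : ℝ) ^ (1 / q) < τ n ω} ≠ ∞ := by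
    refine (lt_of_le_of_lt (ENNReal.tsum_le_tsum fun n => ?_) h1).ne
    by_cases hn : 1 ≤ n
    · simpa only [hn, true_and] using hdom n hn _ (by positivity)
    · simp [hn]
  filter_upwards [ae_eventually_notMem h2] with ω hω
  filter_upwards [hω, eventually_ge_atTop 1] with n hn hn1
  by_contra hcon
  exact hn ⟨hn1, not_le.1 hcon⟩

theorem IsAoIProcess.le_add {τ : ℕ → Ω → ℕ} (hτ : IsAoIProcess τ) {m n : ℕ} (hm : 1 ≤ m)
    (hmn : m ≤ n) (ω : Ω) : τ n ω ≤ τ m ω + (n - m) := by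
  induction n, hmn using Nat.le_induction with
  | base => simp
  | succ n hn ih =>
    have := hτ.unit_growth n (hm.trans hn) ω
    omega

/-- For small `p` the Markov bounds need not be summable over all `n`, but they are along the
geometric times `⌈b ^ k⌉₊`. Between two such times unit growth adds at most `(b - 1) * b ^ k`, which
is the other half of the allowance `ε * b ^ k`. -/
theorem IsAoIProcess.ae_eventually_le_mul (hτ : IsAoIProcess τ)
    (hτbar_nonneg : ∀ ω, 0 ≤ τbar ω) (hp : 0 < p)
    (hmom : Integrable (fun ω => τbar ω ^ p) Q)
    (hdom : ∀ n : ℕ, 1 ≤ n → StochDominated P (fun ω => (τ n ω : ℝ)) Q τbar)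
    {ε : ℝ} (hε : 0 < ε) :
    ∀ᵐ ω ∂P, ∀ᶠ n : ℕ in atTop, (τ n ω : ℝ) ≤ ε * n := by
  set b : ℝ := 1 + ε / 2 with hb
  have hb1 : 1 < b := by linarith
  have hb0 : 0 < b := by linarith
  have hceil : ∀ k, 1 ≤ ⌈b ^ k⌉₊ := fun k => Nat.one_le_ceil_iff.2 (by positivity)
  set I := ∫ ω, τbar ω ^ p ∂Q
  have h2 : ∑' k : ℕ, P {ω | ε / 2 * b ^ k < τ ⌈b ^ k⌉₊ ω} ≠ ∞ := by
    have hle : ∀ k : ℕ, P {ω | ε / 2 * b ^ k < τ ⌈b ^ k⌉₊ ω} ≤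
        ENNReal.ofReal (I / (ε / 2) ^ p * ((b ^ p)⁻¹) ^ k) := fun k => by
      refine (hdom _ (hceil k) _ (by positivity)).trans
        ((measure_gt_le_integral_rpow_div Q hτbar_nonneg hp hmom (by positivity)).trans
          (le_of_eq ?_))
      rw [Real.mul_rpow (by positivity) (by positivity), ← Real.rpow_natCast, ← Real.rpow_natCast,
        ← Real.rpow_mul hb0.le, mul_comm (k : ℝ) p, Real.rpow_mul hb0.le, Real.inv_rpow (by positivity)]
      rw [div_mul_eq_div_div, div_eq_mul_inv (_ / _)]
    have hr : (b ^ p)⁻¹ < 1 := inv_lt_one_of_one_lt₀ (Real.one_lt_rpow hb1 hp)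
    have hsum : Summable fun k : ℕ => I / (ε / 2) ^ p * ((b ^ p)⁻¹) ^ k :=
      (summable_geometric_of_lt_one (by positivity) hr).mul_left _
    have hI : 0 ≤ I := integral_nonneg fun ω => Real.rpow_nonneg (hτbar_nonneg ω) _
    refine ne_top_of_le_ne_top ?_ (ENNReal.tsum_le_tsum hle)
    rw [← ENNReal.ofReal_tsum_of_nonneg (fun k => by positivity) hsum]
    exact ENNReal.ofReal_ne_top
  filter_upwards [ae_eventually_notMem h2] with ω hω
  obtain ⟨k₀, hk₀⟩ := eventually_atTop.1 hω
  filter_upwards [eventually_ge_atTop ⌈b ^ (k₀ + 1)⌉₊, eventually_ge_atTop 1] with n hn hn1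
  obtain ⟨k, hk1, hk2⟩ := exists_nat_pow_near (x := (n : ℝ)) (by exact_mod_cast hn1) hb1
  have hk : k₀ ≤ k := by
    by_contra hcon
    have h3 : b ^ (k + 1) ≤ b ^ (k₀ + 1) := pow_le_pow_right₀ hb1.le (by omega)
    have h4 := Nat.ceil_le.1 hn
    linarith
  have h5 : (τ ⌈b ^ k⌉₊ ω : ℝ) ≤ ε / 2 * b ^ k := not_lt.1 (hk₀ k hk)
  have h6 : ⌈b ^ k⌉₊ ≤ n := Nat.ceil_le.2 hk1
  have h7 : (τ n ω : ℝ) ≤ τ ⌈b ^ k⌉₊ ω + (n - ⌈b ^ k⌉₊) := by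
    rw [← Nat.cast_sub h6]
    exact_mod_cast hτ.le_add (hceil k) h6 ω
  have h8 := Nat.le_ceil (b ^ k)
  rw [pow_succ] at hk2
  have h9 : b ^ k * b = b ^ k + ε / 2 * b ^ k := by rw [hb]; ring
  nlinarith

/-- The decay exponent `r` of the stepsize, and the integrability that it grants for the delay. -/
theorem IsStepsize.exists_rpow {a : ℕ → ℝ} (ha : IsStepsize p a) :
    ∃ a₀ r : ℝ, 0 < a₀ ∧ 1 / 2 < r ∧ r ≤ 1 ∧ (∀ n : ℕ, 1 ≤ n → a n = a₀ * (n : ℝ) ^ (-r)) ∧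
      (r < 1 → 1 < r * p) := by
  obtain ⟨a₀, ha₀, h1, h2⟩ := ha
  rcases le_or_gt p 1 with hp | hp
  · refine ⟨a₀, 1, ha₀, by norm_num, le_rfl, fun n hn => ?_, fun h => absurd h (lt_irrefl _)⟩
    rw [h1 hp n hn, Real.rpow_neg_one, div_eq_mul_inv]
  · obtain ⟨q, hq1, hq2, ha⟩ := h2 hp
    have hq0 : 0 < q := by linarith
    have hq2' := hq2.trans_le (min_le_left _ _)
    have hqp := hq2.trans_le (min_le_right _ _)
    refine ⟨a₀, 1 / q, ha₀, one_div_lt_one_div_of_lt hq0 hq2', ?_, fun n hn => ?_, fun _ => ?_⟩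
    · rw [div_le_one hq0]; exact hq1.le
    · rw [ha n hn, neg_div]
    · rw [one_div_mul_eq_div, one_lt_div hq0]; exact hqp

/-- The age is eventually at most `κ * n ^ r`, while steps in `[n / 2, n]` are at most `a₀ * (n / 2)
^ (-r)`; the powers of `n` cancel. For `r = 1` the age bound uses unit growth, for `r < 1` the
moment of order `1 / r ≤ p`. -/
theorem IsAoIProcess.ae_eventually_sum_stepsize_le (hτ : IsAoIProcess τ)
    (hτbar : Measurable τbar) (hτbar_nonneg : ∀ ω, 0 ≤ τbar ω) (hp : 0 < p)
    (hmom : Integrable (fun ω => τbar ω ^ p) Q)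
    (hdom : ∀ n : ℕ, 1 ≤ n → StochDominated P (fun ω => (τ n ω : ℝ)) Q τbar)
    {a : ℕ → ℝ} (ha : IsStepsize p a) {ε : ℝ} (hε : 0 < ε) :
    ∀ᵐ ω ∂P, ∀ᶠ n : ℕ in atTop, τ n ω < n ∧ ∑ m ∈ Finset.Ico (n - τ n ω) n, a m ≤ ε := by
  obtain ⟨a₀, r, ha₀, hr, hr1, har, hrp⟩ := ha.exists_rpow
  have hr0 : 0 < r := by linarith
  -- `1 / 2` keeps the window inside `[n / 2, n]`; the other term absorbs `a₀` and `2 ^ r ≤ 2`.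
  set κ := min (1 / 2) (ε / (2 * a₀)) with hκ
  have hκ0 : 0 < κ := by positivity
  have hκ2 : κ ≤ 1 / 2 := min_le_left _ _
  have hκε : 2 * a₀ * κ ≤ ε := by
    have : κ ≤ ε / (2 * a₀) := min_le_right _ _
    rw [le_div_iff₀ (by positivity)] at this; linarith
  have hage : ∀ᵐ ω ∂P, ∀ᶠ n : ℕ in atTop, (τ n ω : ℝ) ≤ κ * (n : ℝ) ^ r := by
    rcases hr1.eq_or_lt with h | h
    · simpa only [h, Real.rpow_one] using hτ.ae_eventually_le_mul hτbar_nonneg hp hmom hdom hκ0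
    · have hqp : 1 / r ≤ p := by rw [div_le_iff₀ hr0, mul_comm]; exact (hrp h).le
      simpa only [one_div_one_div] using
        ae_eventually_age_le_mul_rpow hτbar hτbar_nonneg hmom hdom (by positivity) hqp hκ0
  filter_upwards [hage] with ω hω
  filter_upwards [hω, eventually_ge_atTop 1] with n hn hn1
  have hn1' : (1 : ℝ) ≤ n := by exact_mod_cast hn1
  have hnr : (n : ℝ) ^ r ≤ n := by
    simpa using Real.rpow_le_rpow_of_exponent_le hn1' hr1
  have hhalf : (τ n ω : ℝ) ≤ n / 2 := by
    have := mul_le_mul hκ2 hnr (by positivity) (by norm_num)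
    linarith
  have hlt : τ n ω < n := by
    have : (τ n ω : ℝ) < n := by linarith
    exact_mod_cast this
  refine ⟨hlt, ?_⟩
  have hterm : ∀ m ∈ Finset.Ico (n - τ n ω) n, a m ≤ a₀ * ((n : ℝ) / 2) ^ (-r) := fun m hm => by
    have hm1 := (Finset.mem_Ico.1 hm).1
    have hm2 : (n : ℝ) / 2 ≤ m := by
      have : (n : ℝ) - τ n ω ≤ m := by
        rw [← Nat.cast_sub hlt.le]; exact_mod_cast hm1
      linarith
    rw [har m (by omega)]
    exact mul_le_mul_of_nonneg_left
      (Real.rpow_le_rpow_of_nonpos (by positivity) hm2 (by linarith)) ha₀.le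
  refine (Finset.sum_le_card_nsmul _ _ _ hterm).trans (le_trans ?_ hκε)
  rw [Nat.card_Ico, Nat.sub_sub_self hlt.le, nsmul_eq_mul]
  have h2r : (2 : ℝ) ^ r ≤ 2 := by
    simpa using Real.rpow_le_rpow_of_exponent_le (x := 2) (by norm_num) hr1
  calc (τ n ω : ℝ) * (a₀ * ((n : ℝ) / 2) ^ (-r))
      ≤ κ * (n : ℝ) ^ r * (a₀ * ((n : ℝ) / 2) ^ (-r)) := by gcongr
    _ = 2 ^ r * (a₀ * κ) := by
        rw [Real.div_rpow (by positivity) (by norm_num), Real.rpow_neg (by positivity),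
          Real.rpow_neg (by norm_num)]
        have : (n : ℝ) ^ r ≠ 0 := by positivity
        have : (2 : ℝ) ^ r ≠ 0 := by positivity
        field_simp
    _ ≤ 2 * a₀ * κ := by rw [mul_assoc]; gcongr

theorem IsStepsize.summable_sq {a : ℕ → ℝ} (ha : IsStepsize p a) :
    Summable fun n => a n ^ 2 := by
  obtain ⟨a₀, r, ha₀, hr, hr1, har, -⟩ := ha.exists_rpow
  have h : Summable fun n : ℕ => a₀ ^ 2 * (n : ℝ) ^ (-(2 * r)) :=
    (Real.summable_nat_rpow.2 (by linarith)).mul_left _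
  refine (summable_congr_atTop ?_).1 h
  filter_upwards [eventually_ge_atTop 1] with n hn
  rw [har n hn, mul_pow, ← Real.rpow_mul_natCast (by positivity)]
  congr 2
  push_cast
  ring

theorem IsStepsize.pos {a : ℕ → ℝ} (ha : IsStepsize p a) {n : ℕ} (hn : 1 ≤ n) : 0 < a n := by
  obtain ⟨a₀, r, ha₀, -, -, har, -⟩ := ha.exists_rpow
  rw [har n hn]
  have : (0 : ℝ) < n := by exact_mod_cast hn
  positivity

theorem IsStepsize.tendsto_zero {a : ℕ → ℝ} (ha : IsStepsize p a) : Tendsto a atTop (𝓝 0) := by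
  have h := ha.summable_sq.tendsto_atTop_zero
  have h2 := h.sqrt
  rw [Real.sqrt_zero] at h2
  refine h2.congr' ?_
  filter_upwards [eventually_ge_atTop 1] with n hn
  exact Real.sqrt_sq (ha.pos hn).le

end Delay

/-! ### Maximal inequality for the stopped, rescaled noise -/

section Noise

/-- Martingale differences are orthogonal, so the squared norm of the partial sums is a
submartingale with mean at most `∑ v`. Doob's inequality applies on each finite horizon, and the
horizons exhaust the event. -/
theorem measure_exists_norm_sum_ge_le {Ω : Type*} {mΩ : MeasurableSpace Ω} {P : Measure Ω}
    [IsProbabilityMeasure P] {H : Type*} [NormedAddCommGroup H] [InnerProductSpace ℝ H]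
    [CompleteSpace H] {𝒢 : Filtration ℕ mΩ} {X : ℕ → Ω → H}
    (hX : ∀ n, StronglyMeasurable[𝒢 (n + 1)] (X n)) (hX2 : ∀ n, MemLp (X n) 2 P)
    (hX0 : ∀ n, P[X n | 𝒢 n] =ᵐ[P] 0) {v : ℕ → ℝ} (hv : Summable v)
    (hXv : ∀ n, ∫ ω, ‖X n ω‖ ^ 2 ∂P ≤ v n) {η : ℝ} (hη : 0 < η) :
    P {ω | ∃ n, η ≤ ‖∑ m ∈ Finset.range n, X m ω‖} ≤ ENNReal.ofReal ((∑' n, v n) / η ^ 2) := by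
  set Z : ℕ → Ω → H := fun n ω => ∑ m ∈ Finset.range n, X m ω with hZ
  have hv0 : ∀ n, 0 ≤ v n := fun n => (integral_nonneg fun ω => by positivity).trans (hXv n)
  have hZs : ∀ n ω, Z (n + 1) ω = Z n ω + X n ω := fun n ω => Finset.sum_range_succ _ _
  have hZm : ∀ n, StronglyMeasurable[𝒢 n] (Z n) := fun n =>
    Finset.stronglyMeasurable_fun_sum _ fun m hm =>
      (hX m).mono (𝒢.mono (by have := Finset.mem_range.1 hm; omega))
  have hZ2 : ∀ n, MemLp (Z n) 2 P := fun n => memLp_finsetSum _ fun m _ => hX2 m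
  have hinner : ∀ n, Integrable (fun ω => inner ℝ (Z n ω) (X n ω)) P := fun n =>
    (((hZ2 n).integrable_norm_pow two_ne_zero).add ((hX2 n).integrable_norm_pow two_ne_zero)).mono'
      ((hZ2 n).1.inner (hX2 n).1) (ae_of_all _ fun ω => by
        have h1 := norm_inner_le_norm (𝕜 := ℝ) (Z n ω) (X n ω)
        have h2 := two_mul_le_add_sq ‖Z n ω‖ ‖X n ω‖
        have h3 : 0 ≤ ‖Z n ω‖ * ‖X n ω‖ := by positivity
        simp only [Pi.add_apply]
        linarith)
  have hcross : ∀ n, P[fun ω => inner ℝ (Z n ω) (X n ω) | 𝒢 n] =ᵐ[P] 0 := fun n => by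
    have h := condExp_bilin_of_stronglyMeasurable_left (innerSL ℝ) (hZm n) (hinner n)
      ((hX2 n).integrable one_le_two)
    filter_upwards [h, hX0 n] with ω h1 h2
    refine Eq.trans h1 ?_
    rw [h2]; simp
  have hsq : ∀ n ω, ‖Z (n + 1) ω‖ ^ 2 =
      ‖Z n ω‖ ^ 2 + (2 * inner ℝ (Z n ω) (X n ω) + ‖X n ω‖ ^ 2) := fun n ω => by
    rw [hZs, norm_add_sq_real]; ring
  have hint : ∀ n, Integrable (fun ω => ‖Z n ω‖ ^ 2) P := fun n => (hZ2 n).integrable_norm_pow two_ne_zero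
  have hXint : ∀ n, Integrable (fun ω => ‖X n ω‖ ^ 2) P := fun n =>
    (hX2 n).integrable_norm_pow two_ne_zero
  have hsub : Submartingale (fun n ω => ‖Z n ω‖ ^ 2) 𝒢 P := by
    refine submartingale_of_condExp_sub_nonneg_nat (fun n => (hZm n).norm.pow 2) hint fun n => ?_
    have heq : (fun ω => ‖Z (n + 1) ω‖ ^ 2) - (fun ω => ‖Z n ω‖ ^ 2) =
        (2 : ℝ) • (fun ω => inner ℝ (Z n ω) (X n ω)) + fun ω => ‖X n ω‖ ^ 2 := by
      ext ω
      simp only [Pi.sub_apply, Pi.add_apply, Pi.smul_apply, hsq, smul_eq_mul]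
      ring
    rw [heq]
    filter_upwards [condExp_add ((hinner n).smul (2 : ℝ)) (hXint n) (𝒢 n),
      condExp_smul (μ := P) (2 : ℝ) (fun ω => inner ℝ (Z n ω) (X n ω)) (𝒢 n), hcross n,
      condExp_nonneg (μ := P) (m := 𝒢 n) (f := fun ω => ‖X n ω‖ ^ 2)
        (ae_of_all _ fun ω => by positivity)] with ω h1 h2 h3 h4
    rw [h1, Pi.add_apply, h2, Pi.smul_apply, h3]
    simpa using h4
  have hE : ∀ n, ∫ ω, ‖Z n ω‖ ^ 2 ∂P ≤ ∑ m ∈ Finset.range n, v m := fun n => by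
    induction n with
    | zero => simp [hZ]
    | succ n ih =>
      have h0 : ∫ ω, inner ℝ (Z n ω) (X n ω) ∂P = 0 := by
        rw [← integral_condExp (𝒢.le n), integral_congr_ae (hcross n)]; simp
      simp_rw [hsq]
      rw [integral_add (g := fun ω => 2 * inner ℝ (Z n ω) (X n ω) + ‖X n ω‖ ^ 2) (hint n)
          (((hinner n).const_mul 2).add (hXint n)),
        integral_add ((hinner n).const_mul 2) (hXint n), integral_const_mul, h0,
        Finset.sum_range_succ]
      linarith [hXv n]
  set S : ℕ → Set Ω := fun N => {ω | ∃ n ≤ N, η ≤ ‖Z n ω‖} with hS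
  have hSmono : Monotone S := fun N N' h ω ⟨n, hn, hω⟩ => ⟨n, hn.trans h, hω⟩
  have hSU : {ω | ∃ n, η ≤ ‖Z n ω‖} = ⋃ N, S N := by
    ext ω
    simp only [Set.mem_iUnion]
    exact ⟨fun ⟨n, hn⟩ => ⟨n, n, le_rfl, hn⟩, fun ⟨_, n, _, hn⟩ => ⟨n, hn⟩⟩
  change P {ω | ∃ n, η ≤ ‖Z n ω‖} ≤ _
  rw [hSU, hSmono.measure_iUnion]
  refine iSup_le fun N => ?_
  obtain ⟨ε, hε⟩ : ∃ ε : ℝ≥0, (ε : ℝ) = η ^ 2 := ⟨⟨η ^ 2, by positivity⟩, rfl⟩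
  have hset : {ω | (ε : ℝ) ≤
      (Finset.range (N + 1)).sup' Finset.nonempty_range_add_one fun k => ‖Z k ω‖ ^ 2} = S N := by
    ext ω
    simp only [Set.mem_ofPred_eq, hS, Finset.le_sup'_iff, Finset.mem_range, hε,
      Nat.lt_succ_iff]
    refine exists_congr fun n => and_congr_right fun _ => ?_
    exact pow_le_pow_iff_left₀ hη.le (norm_nonneg _) two_ne_zero
  have hmax : ε * P (S N) ≤ ENNReal.ofReal (∫ ω in S N, ‖Z N ω‖ ^ 2 ∂P) := by
    rw [← hset]
    exact maximal_ineq hsub (fun n ω => by positivity) N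
  have hbound : ENNReal.ofReal (∫ ω in S N, ‖Z N ω‖ ^ 2 ∂P) ≤ ENNReal.ofReal (∑' n, v n) := by
    refine ENNReal.ofReal_le_ofReal ((setIntegral_le_integral (hint N)
      (ae_of_all _ fun ω => by positivity)).trans ((hE N).trans ?_))
    exact hv.sum_le_tsum _ fun n _ => hv0 n
  rw [← ENNReal.ofReal_coe_nnreal, hε] at hmax
  rw [ENNReal.ofReal_div_of_pos (by positivity), ENNReal.le_div_iff_mul_le
    (Or.inl (by simpa using hη.ne')) (Or.inl ENNReal.ofReal_ne_top), mul_comm]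
  exact hmax.trans hbound

variable {Ω : Type*} {D : ℕ} {d : Fin D → ℕ}

theorem history_mono (x M : ℕ → Ω → BlockSpace d) (τ : Fin D → Fin D → ℕ → Ω → ℕ) :
    Monotone (history x M τ) := by
  intro n m hnm
  refine sup_le_sup (sup_le_sup le_rfl ?_) ?_
  · exact biSup_mono fun k hk => ⟨hk.1, hk.2.trans hnm⟩
  · refine iSup_le fun h2 => ?_
    exact le_trans (biSup_mono fun k hk => ⟨hk.1, hk.2.trans hnm⟩)
      (le_iSup_of_le (h2.trans hnm) le_rfl)

theorem measurable_initial_history (x M : ℕ → Ω → BlockSpace d)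
    (τ : Fin D → Fin D → ℕ → Ω → ℕ) (n : ℕ) :
    Measurable[history x M τ n] (x 0) ∧ Measurable[history x M τ n] (x 1) :=
  ⟨Measurable.of_comap_le (le_sup_of_le_left (le_sup_of_le_left le_sup_left)),
    Measurable.of_comap_le (le_sup_of_le_left (le_sup_of_le_left le_sup_right))⟩

theorem measurable_noise_history (x M : ℕ → Ω → BlockSpace d)
    (τ : Fin D → Fin D → ℕ → Ω → ℕ) {k n : ℕ} (hk : 2 ≤ k) (hkn : k ≤ n) :
    Measurable[history x M τ n] (M k) :=
  Measurable.of_comap_le (le_sup_of_le_left (le_sup_of_le_right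
    (le_iSup₂_of_le k ⟨hk, hkn⟩ le_rfl)))

theorem measurable_age_history (x M : ℕ → Ω → BlockSpace d)
    (τ : Fin D → Fin D → ℕ → Ω → ℕ) {k n : ℕ} (hk : 1 ≤ k) (hkn : k ≤ n) (hn : 2 ≤ n)
    (i j : Fin D) : Measurable[history x M τ n] (τ i j k) :=
  Measurable.of_comap_le (le_sup_of_le_right (le_iSup_of_le hn
    (le_iSup₂_of_le k ⟨hk, hkn⟩ (le_iSup_of_le i (le_iSup_of_le j le_rfl)))))

theorem measurable_apply_of_le {Ω β : Type*} {m : MeasurableSpace Ω} [MeasurableSpace β]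
    {G : ℕ → Ω → β} {σ : Ω → ℕ} {n : ℕ} (hG : ∀ k ≤ n, Measurable (G k)) (hσ : Measurable σ)
    (hσn : ∀ ω, σ ω ≤ n) : Measurable fun ω => G (σ ω) ω := by
  -- The clamp at `n` is needed because `G k` is known to be measurable only for `k ≤ n`.
  have h : Measurable fun q : ℕ × Ω => G (min q.1 n) q.2 :=
    measurable_from_prod_countable_right fun k => hG _ (min_le_right _ _)
  simpa only [Function.comp_def, id, min_eq_left (hσn _)] using h.comp (hσ.prodMk measurable_id)

theorem IsDistributedSA.measurable_succ {m : MeasurableSpace Ω} {h : BlockSpace d → BlockSpace d}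
    (hh : Measurable h) {a : ℕ → ℝ} {τ : Fin D → Fin D → ℕ → Ω → ℕ} {x M : ℕ → Ω → BlockSpace d}
    (hx : IsDistributedSA h a τ x M) {n : ℕ} (hn : 1 ≤ n) (hxm : ∀ k ≤ n, Measurable (x k))
    (hτ : ∀ i j, Measurable (τ i j n)) (hM : Measurable (M (n + 1))) :
    Measurable (x (n + 1)) := by
  have happ : ∀ i : Fin D, Measurable fun y : BlockSpace d => y i := fun i => by fun_prop
  have haged : ∀ i, Measurable (agedState x τ i n) := fun i => by
    refine (WithLp.measurable_toLp 2 _).comp (measurable_pi_iff.2 fun j => ?_)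
    exact (happ j).comp (measurable_apply_of_le (n := n) hxm (measurable_const.sub (hτ i j))
      fun ω => Nat.sub_le _ _)
  have heq : x (n + 1) = fun ω => WithLp.toLp 2 fun i =>
      x n ω i + a n • (h (agedState x τ i n ω) i + M (n + 1) ω i) := by
    ext1 ω
    ext1 i
    exact hx n hn ω i
  rw [heq]
  refine (WithLp.measurable_toLp 2 _).comp (measurable_pi_iff.2 fun i => ?_)
  exact ((happ i).comp (hxm n le_rfl)).add
    ((((happ i).comp (hh.comp (haged i))).add ((happ i).comp hM)).const_smul (a n))

/-- The new iterate depends on earlier ones, on the noise `M (n + 1)` and on the ages at time `n`,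
all part of the history at `n + 1 ≥ 2`. -/
theorem measurable_iterate_history {h : BlockSpace d → BlockSpace d}
    (hh : Measurable h) {a : ℕ → ℝ} {τ : Fin D → Fin D → ℕ → Ω → ℕ} {x M : ℕ → Ω → BlockSpace d}
    (hx : IsDistributedSA h a τ x M) (n : ℕ) : ∀ k ≤ n, Measurable[history x M τ n] (x k) := by
  induction n with
  | zero =>
    intro k hk
    rw [Nat.le_zero.1 hk]
    exact (measurable_initial_history x M τ 0).1
  | succ n ih =>
    intro k hk
    rcases hk.lt_or_eq with hlt | rfl
    · exact (ih k (by omega)).mono (history_mono x M τ n.le_succ) le_rfl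
    rcases Nat.eq_zero_or_pos n with rfl | hn
    · exact (measurable_initial_history x M τ 1).2
    exact hx.measurable_succ hh hn
      (fun k hk => (ih k hk).mono (history_mono x M τ n.le_succ) le_rfl)
      (fun i j => measurable_age_history x M τ hn n.le_succ (by omega) i j)
      (measurable_noise_history x M τ (by omega) le_rfl)

/-- The event that the iterates have stayed in the ball of radius `c` up to time `n`. -/
def stayEvent {E : Type*} [NormedAddCommGroup E] (x : ℕ → Ω → E) (c : ℝ) (n : ℕ) : Set Ω :=
  {ω | ∀ m ≤ n, ‖x m ω‖ ≤ c}

theorem measurableSet_stayEvent {E : Type*} [NormedAddCommGroup E] [MeasurableSpace E]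
    [OpensMeasurableSpace E] {m : MeasurableSpace Ω} {x : ℕ → Ω → E} {n : ℕ}
    (hx : ∀ k ≤ n, Measurable (x k)) (c : ℝ) : MeasurableSet (stayEvent x c n) := by
  have : stayEvent x c n = ⋂ k ∈ Set.Iic n, {ω | ‖x k ω‖ ≤ c} := by
    ext ω; simp [stayEvent]
  rw [this]
  exact MeasurableSet.biInter (Set.to_countable _) fun k hk =>
    measurableSet_le (hx k hk).norm measurable_const

/-- The rescaled noise increment of block `i`, switched off once the iterates leave the ball. -/
noncomputable def stoppedNoise (a : ℕ → ℝ) (x M : ℕ → Ω → BlockSpace d) (c : ℝ) (i : Fin D)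
    (n : ℕ) : Ω → EuclideanSpace ℝ (Fin (d i)) :=
  (a n / c) • (stayEvent x c n).indicator fun ω => M (n + 1) ω i

theorem norm_sq_agedState_le {τ : Fin D → Fin D → ℕ → Ω → ℕ} {x : ℕ → Ω → BlockSpace d}
    {n : ℕ} {ω : Ω} {c : ℝ} (hc : ∀ m ≤ n, ‖x m ω‖ ≤ c) (i : Fin D) :
    ‖agedState x τ i n ω‖ ^ 2 ≤ D * c ^ 2 := by
  rw [PiLp.norm_sq_eq_of_L2]
  have : ∀ j ∈ Finset.univ, ‖(agedState x τ i n ω) j‖ ^ 2 ≤ c ^ 2 := fun j _ => by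
    have := (PiLp.norm_apply_le (x (n - τ i j n ω) ω) j).trans (hc _ (Nat.sub_le _ _))
    exact pow_le_pow_left₀ (norm_nonneg _) this 2
  simpa using Finset.sum_le_card_nsmul _ _ _ this

variable [MeasurableSpace Ω] {P : Measure Ω}

theorem history_le {K : ℝ} {τ : Fin D → Fin D → ℕ → Ω → ℕ} {x M : ℕ → Ω → BlockSpace d}
    (hx0 : Measurable (x 0)) (hx1 : Measurable (x 1)) (hM : IsNoise P τ x M K)
    (hτ : ∀ i j, IsAoIProcess (τ i j)) (n : ℕ) : history x M τ n ≤ ‹MeasurableSpace Ω› := by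
  refine sup_le (sup_le (sup_le hx0.comap_le hx1.comap_le) (iSup₂_le fun k hk => ?_))
    (iSup_le fun _ => iSup₂_le fun k hk => iSup_le fun i => iSup_le fun j =>
      ((hτ i j).measurable k hk.1).comap_le)
  have := hM.measurable (k - 1) (by have := hk.1; omega)
  rw [Nat.sub_add_cancel (by have := hk.1; omega)] at this
  exact this.comap_le

/-- The switch belongs to the history, so the martingale property survives. Inside the ball the
conditional variance is at most `K ^ 2 * (1 + D * c ^ 2) ≤ K ^ 2 * (1 + D) * c ^ 2`, and rescaling
cancels `c ^ 2`: the bound is free of `c`. -/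
theorem measure_exists_stoppedNoise_ge_le [IsProbabilityMeasure P]
    {h : BlockSpace d → BlockSpace d} (hh : Measurable h) {a : ℕ → ℝ}
    {τ : Fin D → Fin D → ℕ → Ω → ℕ} {x M : ℕ → Ω → BlockSpace d} {K : ℝ}
    (hx : IsDistributedSA h a τ x M) (hx0 : Measurable (x 0)) (hx1 : Measurable (x 1))
    (hM : IsNoise P τ x M K) (hτ : ∀ i j, IsAoIProcess (τ i j))
    (ha : Summable fun n => a n ^ 2) {c : ℝ} (hc : 1 ≤ c) {n₀ : ℕ} (hn₀ : 1 ≤ n₀)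
    {η : ℝ} (hη : 0 < η) (i : Fin D) :
    P {ω | ∃ n, η ≤ ‖∑ m ∈ Finset.range n, stoppedNoise a x M c i (n₀ + m) ω‖} ≤
      ENNReal.ofReal ((∑' n, K ^ 2 * (1 + D) * a (n₀ + n) ^ 2) / η ^ 2) := by
  have hc0 : 0 < c := by linarith
  have hle := history_le hx0 hx1 hM hτ
  set 𝒢 : Filtration ℕ ‹MeasurableSpace Ω› :=
    ⟨fun n => history x M τ (n₀ + n), fun n m hnm => history_mono x M τ (by omega),
      fun n => hle _⟩ with h𝒢
  have happ : Measurable fun y : BlockSpace d => y i := by fun_prop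
  have hstay : ∀ n, MeasurableSet[history x M τ n] (stayEvent x c n) := fun n =>
    measurableSet_stayEvent (measurable_iterate_history hh hx n) c
  have hMi : ∀ n, 1 ≤ n → MemLp (fun ω => M (n + 1) ω i) 2 P := fun n hn =>
    (hM.memLp n hn).mono (happ.comp (hM.measurable n hn)).aestronglyMeasurable
      (ae_of_all _ fun ω => PiLp.norm_apply_le _ i)
  refine measure_exists_norm_sum_ge_le (𝒢 := 𝒢) (fun n => ?_) (fun n => ?_) (fun n => ?_)
    ((((summable_nat_add_iff n₀).2 ha).congr fun n => by rw [add_comm]).mul_left _) (fun n => ?_) hη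
  · have h1 : Measurable[history x M τ (n₀ + (n + 1))] fun ω => M (n₀ + n + 1) ω i :=
      happ.comp (measurable_noise_history x M τ (by omega) (by omega))
    have h2 : MeasurableSet[history x M τ (n₀ + (n + 1))] (stayEvent x c (n₀ + n)) :=
      history_mono x M τ (by omega) _ (hstay _)
    exact ((h1.indicator h2).const_smul _).stronglyMeasurable
  · exact ((hMi _ (by omega)).indicator (hle _ _ (hstay _))).const_smul _
  · have h1 := condExp_smul (μ := P) (a (n₀ + n) / c) ((stayEvent x c (n₀ + n)).indicator
      fun ω => M (n₀ + n + 1) ω i) (history x M τ (n₀ + n))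
    have h2 := condExp_indicator (m := history x M τ (n₀ + n))
      ((hMi (n₀ + n) (by omega)).integrable one_le_two) (hstay (n₀ + n))
    filter_upwards [h1, h2, hM.condExp_eq_zero (n₀ + n) (by omega) i] with ω e1 e2 e3
    refine e1.trans ?_
    rw [Pi.smul_apply, e2]
    by_cases hω : ω ∈ stayEvent x c (n₀ + n) <;> simp [hω, e3]
  · set N := n₀ + n with hN
    have hN1 : 1 ≤ N := by omega
    have hint : Integrable (fun ω => ‖M (N + 1) ω i‖ ^ 2) P :=
      (hMi N hN1).integrable_norm_pow two_ne_zero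
    have h1 : ∀ ω, ‖stoppedNoise a x M c i N ω‖ ^ 2 = (a N / c) ^ 2 *
        (stayEvent x c N).indicator (fun ω => ‖M (N + 1) ω i‖ ^ 2) ω := fun ω => by
      rw [stoppedNoise, Pi.smul_apply, norm_smul, mul_pow, Real.norm_eq_abs, sq_abs]
      congr 1
      by_cases hω : ω ∈ stayEvent x c N <;> simp [hω]
    simp_rw [h1]
    rw [integral_const_mul, integral_indicator (hle _ _ (hstay N)),
      ← setIntegral_condExp (hle N) hint (hstay N)]
    have h2 : ∫ ω in stayEvent x c N, (P[fun ω => ‖M (N + 1) ω i‖ ^ 2 | history x M τ N]) ω ∂P ≤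
        ∫ ω in stayEvent x c N, K ^ 2 * (1 + D * c ^ 2) ∂P := by
      refine setIntegral_mono_on_ae integrable_condExp.integrableOn
        (integrable_const _).integrableOn (hle _ _ (hstay N)) ?_
      filter_upwards [hM.condExp_sq_le N hN1 i] with ω hω hmem
      refine hω.trans ?_
      gcongr
      exact norm_sq_agedState_le hmem i
    have h3 : ∫ ω in stayEvent x c N, K ^ 2 * (1 + D * c ^ 2) ∂P ≤ K ^ 2 * (1 + D) * c ^ 2 := by
      rw [setIntegral_const, smul_eq_mul]
      have hc2 : 1 ≤ c ^ 2 := one_le_pow₀ hc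
      calc P.real (stayEvent x c N) * (K ^ 2 * (1 + D * c ^ 2))
          ≤ 1 * (K ^ 2 * (c ^ 2 + D * c ^ 2)) := by
            gcongr
            exact measureReal_le_one
        _ = _ := by ring
    calc _ ≤ (a N / c) ^ 2 * (K ^ 2 * (1 + D) * c ^ 2) := by
          gcongr
          exact h2.trans h3
      _ = _ := by field_simp

end Noise

/-! ### Uniform convergence of the rescaled drifts -/

section Scaling

variable {E : Type*} [NormedAddCommGroup E] [NormedSpace ℝ E] {h hInf : E → E} {L : ℝ≥0}
  {c : ℕ → ℝ}

theorem LipschitzWith.norm_rescaled_sub_le (hL : LipschitzWith L h) {r : ℝ} (hr : 0 < r)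
    (y z : E) : ‖r⁻¹ • h (r • y) - r⁻¹ • h (r • z)‖ ≤ L * ‖y - z‖ := by
  rw [← smul_sub, norm_smul, Real.norm_of_nonneg (by positivity)]
  have h1 := hL.norm_sub_le (r • y) (r • z)
  rw [← smul_sub, norm_smul, Real.norm_of_nonneg hr.le] at h1
  calc r⁻¹ * ‖h (r • y) - h (r • z)‖ ≤ r⁻¹ * (L * (r * ‖y - z‖)) := by gcongr
    _ = L * ‖y - z‖ := by field_simp

theorem LipschitzWith.scaling_limit (hL : LipschitzWith L h) (hc : ∀ n, 1 ≤ c n)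
    (hlim : ∀ y, Tendsto (fun n => (c n)⁻¹ • h (c n • y)) atTop (𝓝 (hInf y))) :
    LipschitzWith L hInf := by
  refine LipschitzWith.of_dist_le_mul fun y z => ?_
  rw [dist_eq_norm, dist_eq_norm]
  exact le_of_tendsto ((hlim y).sub (hlim z)).norm (Eventually.of_forall fun n =>
    hL.norm_rescaled_sub_le (zero_lt_one.trans_le (hc n)) y z)

/-- Equi-Lipschitz maps that converge at the points of a finite net converge uniformly on the ball;
two Lipschitz errors and one pointwise error share `ε`. -/
theorem LipschitzWith.eventually_norm_rescaled_sub_limit_le [ProperSpace E]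
    (hL : LipschitzWith L h) (hc : ∀ n, 1 ≤ c n)
    (hlim : ∀ y, Tendsto (fun n => (c n)⁻¹ • h (c n • y)) atTop (𝓝 (hInf y))) {ε : ℝ}
    (hε : 0 < ε) :
    ∀ᶠ n in atTop, ∀ y, ‖y‖ ≤ 1 → ‖(c n)⁻¹ • h (c n • y) - hInf y‖ ≤ ε := by
  have hInfL := hL.scaling_limit hc hlim
  set ρ := ε / (2 * L + 1) with hρ
  have hρ0 : 0 < ρ := by positivity
  obtain ⟨s, -, hs⟩ := (isCompact_closedBall (0 : E) 1).elim_nhds_subcover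
    (fun z => Metric.ball z (ρ / 2)) (fun z _ => Metric.ball_mem_nhds z (half_pos hρ0))
  have hev : ∀ᶠ n in atTop, ∀ z ∈ s, ‖(c n)⁻¹ • h (c n • z) - hInf z‖ < ρ := by
    rw [eventually_all_finset]
    intro z _
    have := ((hlim z).sub_const (hInf z)).norm
    rw [sub_self, norm_zero] at this
    exact this.eventually_lt_const hρ0
  filter_upwards [hev] with n hn y hy
  have hmem := hs (show y ∈ Metric.closedBall (0 : E) 1 by simpa using hy)
  simp only [Set.mem_iUnion, Metric.mem_ball, exists_prop] at hmem
  obtain ⟨z, hz, hd⟩ := hmem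
  rw [dist_eq_norm] at hd
  have h1 := hL.norm_rescaled_sub_le (zero_lt_one.trans_le (hc n)) y z
  have h2 := hInfL.norm_sub_le z y
  rw [norm_sub_rev z y] at h2
  have h3 : ‖(c n)⁻¹ • h (c n • y) - hInf y‖ ≤ ‖(c n)⁻¹ • h (c n • y) - (c n)⁻¹ • h (c n • z)‖ +
      ‖(c n)⁻¹ • h (c n • z) - hInf z‖ + ‖hInf z - hInf y‖ := by
    refine le_trans (le_of_eq ?_) (norm_add₃_le)
    congr 1
    abel
  have h4 : (L : ℝ) * ‖y - z‖ ≤ L * ρ := by gcongr; linarith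
  have h5 : ρ * (2 * L + 1) = ε := by rw [hρ]; field_simp
  linarith [hn z hz]

end Scaling

/-! ### Pathwise confinement when all errors are small -/

section Path

variable {D : ℕ} {d : Fin D → ℕ}

theorem norm_le_card_mul_of_forall_norm_le {v : BlockSpace d} {b : ℝ} (hb : 0 ≤ b)
    (hv : ∀ i, ‖v i‖ ≤ b) : ‖v‖ ≤ D * b := by
  refine (pow_le_pow_iff_left₀ (norm_nonneg _) (by positivity) two_ne_zero).1 ?_
  rw [PiLp.norm_sq_eq_of_L2]
  have h1 : ∀ i ∈ Finset.univ, ‖v i‖ ^ 2 ≤ b ^ 2 := fun i _ =>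
    pow_le_pow_left₀ (norm_nonneg _) (hv i) 2
  have h2 := Finset.sum_le_card_nsmul _ _ _ h1
  rw [Finset.card_univ, Fintype.card_fin, nsmul_eq_mul] at h2
  have h3 : (D : ℝ) ≤ (D : ℝ) ^ 2 := by exact_mod_cast Nat.le_self_pow two_ne_zero D
  rw [mul_pow]
  exact h2.trans (by gcongr)

variable {Ω : Type*} {h : BlockSpace d → BlockSpace d} {a : ℕ → ℝ}
  {τ : Fin D → Fin D → ℕ → Ω → ℕ} {x M : ℕ → Ω → BlockSpace d} {L : ℝ≥0} {c : ℝ} {ω : Ω}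

/-- The drift at time `n`, each block evaluated at the aged state it uses. -/
def agedDrift (h : BlockSpace d → BlockSpace d) (x : ℕ → Ω → BlockSpace d)
    (τ : Fin D → Fin D → ℕ → Ω → ℕ) (n : ℕ) (ω : Ω) : BlockSpace d :=
  WithLp.toLp 2 fun i => h (agedState x τ i n ω) i

/-- The accumulated rescaled noise from time `n₀` on, switched off once the iterates leave the
ball. -/
noncomputable def noiseSum (a : ℕ → ℝ) (x M : ℕ → Ω → BlockSpace d) (c : ℝ) (n₀ n : ℕ) (ω : Ω) :
    BlockSpace d :=
  WithLp.toLp 2 fun i => ∑ m ∈ Finset.range n, stoppedNoise a x M c i (n₀ + m) ω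

theorem IsDistributedSA.step_of_mem_stayEvent (hx : IsDistributedSA h a τ x M) (hc : c ≠ 0)
    {n₀ : ℕ} (hn₀ : 1 ≤ n₀) (n : ℕ) (hω : ω ∈ stayEvent x c (n₀ + n)) :
    x (n₀ + n + 1) ω = x (n₀ + n) ω + a (n₀ + n) • agedDrift h x τ (n₀ + n) ω +
      c • (noiseSum a x M c n₀ (n + 1) ω - noiseSum a x M c n₀ n ω) := by
  ext1 i
  have h1 : (noiseSum a x M c n₀ (n + 1) ω - noiseSum a x M c n₀ n ω) i =
      (a (n₀ + n) / c) • M (n₀ + n + 1) ω i := by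
    simp only [noiseSum, PiLp.sub_apply, Finset.sum_range_succ, add_sub_cancel_left]
    simp [stoppedNoise, hω]
  rw [hx _ (by omega), PiLp.add_apply, PiLp.add_apply, PiLp.smul_apply, PiLp.smul_apply, h1,
    smul_smul, mul_div_cancel₀ _ hc, smul_add, ← add_assoc]
  rfl

theorem norm_agedDrift_le (hL : LipschitzWith L h) (hc : 1 ≤ c) {n : ℕ}
    (hω : ω ∈ stayEvent x c n) :
    ‖agedDrift h x τ n ω‖ ≤ D * (‖h 0‖ + L * D) * c := by
  rw [mul_assoc]
  refine norm_le_card_mul_of_forall_norm_le (by positivity) fun i => ?_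
  have h1 : ‖agedState x τ i n ω‖ ≤ D * c :=
    norm_le_card_mul_of_forall_norm_le (by positivity) fun j =>
      (PiLp.norm_apply_le (x (n - τ i j n ω) ω) j).trans (hω _ (Nat.sub_le _ _))
  have h2 := hL.norm_sub_le (agedState x τ i n ω) 0
  rw [sub_zero] at h2
  have h3 : ‖h (agedState x τ i n ω)‖ ≤ ‖h (agedState x τ i n ω) - h 0‖ + ‖h 0‖ := by
    simpa using norm_add_le (h (agedState x τ i n ω) - h 0) (h 0)
  have h4 : (L : ℝ) * ‖agedState x τ i n ω‖ ≤ L * (D * c) := by gcongr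
  have h5 : ‖h 0‖ ≤ ‖h 0‖ * c := le_mul_of_one_le_right (norm_nonneg _) hc
  refine (PiLp.norm_apply_le (h (agedState x τ i n ω)) i).trans ?_
  linarith

/-- Inside the ball the drift is of order `c` and the noise telescopes, so displacement is governed
by elapsed stepsize time. -/
theorem IsDistributedSA.norm_sub_le_of_mem_stayEvent (hx : IsDistributedSA h a τ x M)
    (hL : LipschitzWith L h) (hc : 1 ≤ c) {n₀ : ℕ} (hn₀ : 1 ≤ n₀)
    (ha : ∀ n, n₀ ≤ n → 0 ≤ a n) {b : ℝ} (hb : ∀ n, ‖noiseSum a x M c n₀ n ω‖ ≤ b) (s k : ℕ)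
    (hω : ω ∈ stayEvent x c (n₀ + (s + k))) :
    ‖x (n₀ + (s + k)) ω - x (n₀ + s) ω‖ ≤
      (D * (‖h 0‖ + L * D) * (∑ m ∈ Finset.Ico (n₀ + s) (n₀ + (s + k)), a m) + 2 * b) * c := by
  have hc0 : 0 < c := by linarith
  set ζ := fun n => noiseSum a x M c n₀ n ω with hζ
  set G := D * (‖h 0‖ + L * D) with hG
  have key : ∀ l ≤ k, ‖x (n₀ + (s + l)) ω - x (n₀ + s) ω - c • (ζ (s + l) - ζ s)‖ ≤
      G * c * ∑ m ∈ Finset.Ico (n₀ + s) (n₀ + (s + l)), a m := by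
    intro l
    induction l with
    | zero => simp
    | succ l ih =>
      intro hl
      have hstay : ω ∈ stayEvent x c (n₀ + (s + l)) := fun m hm => hω m (by omega)
      have hstep := hx.step_of_mem_stayEvent hc0.ne' hn₀ (s + l) hstay
      have heq : x (n₀ + (s + (l + 1))) ω - x (n₀ + s) ω - c • (ζ (s + (l + 1)) - ζ s) =
          (x (n₀ + (s + l)) ω - x (n₀ + s) ω - c • (ζ (s + l) - ζ s)) +
            a (n₀ + (s + l)) • agedDrift h x τ (n₀ + (s + l)) ω := by
        rw [show n₀ + (s + (l + 1)) = n₀ + (s + l) + 1 by omega, hstep,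
          show s + (l + 1) = s + l + 1 by omega]
        simp only [hζ, smul_sub]
        abel
      rw [heq, show n₀ + (s + (l + 1)) = n₀ + (s + l) + 1 by omega,
        Finset.sum_Ico_succ_top (by omega), mul_add]
      refine (norm_add_le _ _).trans (add_le_add (ih (by omega)) ?_)
      rw [norm_smul, Real.norm_of_nonneg (ha _ (by omega)), mul_comm]
      exact mul_le_mul_of_nonneg_right (norm_agedDrift_le hL hc hstay) (ha _ (by omega))
  have h1 := key k le_rfl
  have h2 : ‖c • (ζ (s + k) - ζ s)‖ ≤ c * (2 * b) := by
    rw [norm_smul, Real.norm_of_nonneg hc0.le]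
    gcongr
    linarith [norm_sub_le (ζ (s + k)) (ζ s), hb (s + k), hb s]
  have h3 := norm_add_le (x (n₀ + (s + k)) ω - x (n₀ + s) ω - c • (ζ (s + k) - ζ s))
    (c • (ζ (s + k) - ζ s))
  rw [sub_add_cancel] at h3
  linarith

/-- The aged time `m` may precede `n₀`, where the noise sum gives no control. Then `x m` and `x n₀`
are both at most `ε * c`, which accounts for the term `2 * ε`. -/
theorem IsDistributedSA.norm_sub_aged_le (hx : IsDistributedSA h a τ x M)
    (hL : LipschitzWith L h) (hc : 1 ≤ c) {n₀ : ℕ} (hn₀ : 1 ≤ n₀)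
    (ha : ∀ n, 1 ≤ n → 0 ≤ a n) {b ε : ℝ} (hb : ∀ n, ‖noiseSum a x M c n₀ n ω‖ ≤ b)
    (hε : 0 ≤ ε) (hinit : ∀ m ≤ n₀, ‖x m ω‖ ≤ ε * c) {n m : ℕ} (hm : 1 ≤ m) (hmn : m ≤ n)
    (hn : n₀ ≤ n) (hsum : ∑ l ∈ Finset.Ico m n, a l ≤ ε) (hω : ω ∈ stayEvent x c n) :
    ‖x n ω - x m ω‖ ≤ (D * (‖h 0‖ + L * D) * ε + 2 * b + 2 * ε) * c := by
  have hc0 : 0 < c := by linarith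
  have hεc : 0 ≤ ε * c := by positivity
  rcases le_total n₀ m with hnm | hnm
  · obtain ⟨s, rfl⟩ := Nat.exists_eq_add_of_le hnm
    obtain ⟨k, rfl⟩ := Nat.exists_eq_add_of_le hmn
    rw [add_assoc] at *
    have h1 := hx.norm_sub_le_of_mem_stayEvent hL hc hn₀ (fun n hn => ha n (hn₀.trans hn)) hb s k hω
    refine h1.trans (mul_le_mul_of_nonneg_right ?_ hc0.le)
    have : (D * (‖h 0‖ + L * D)) * ∑ l ∈ Finset.Ico (n₀ + s) (n₀ + (s + k)), a l ≤
        D * (‖h 0‖ + L * D) * ε := by gcongr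
    linarith
  · obtain ⟨k, rfl⟩ := Nat.exists_eq_add_of_le hn
    have h1 := hx.norm_sub_le_of_mem_stayEvent hL hc hn₀ (fun n hn => ha n (hn₀.trans hn)) hb 0 k
      (by simpa using hω)
    simp only [zero_add, add_zero] at h1
    have h2 : ∑ l ∈ Finset.Ico n₀ (n₀ + k), a l ≤ ε :=
      (Finset.sum_le_sum_of_subset_of_nonneg (Finset.Ico_subset_Ico_left hnm)
        fun l hl _ => ha l (hm.trans (Finset.mem_Ico.1 hl).1)).trans hsum
    have h3 : (D * (‖h 0‖ + L * D)) * ∑ l ∈ Finset.Ico n₀ (n₀ + k), a l ≤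
        D * (‖h 0‖ + L * D) * ε := by gcongr
    have h4 := norm_sub_le_norm_sub_add_norm_sub (x (n₀ + k) ω) (x n₀ ω) (x m ω)
    have h5 := norm_sub_le (x n₀ ω) (x m ω)
    have h6 := mul_le_mul_of_nonneg_right h3 hc0.le
    linarith [hinit n₀ le_rfl, hinit m hnm]

/-- The factor by which the pathwise errors of size `ε` enter the perturbed Euler scheme. -/
noncomputable def errorFactor (D : ℕ) (L b : ℝ) : ℝ :=
  D * (L * (D * (D * (b + L * D) + 2 * D + 2)) + 1)

theorem IsDistributedSA.norm_le_of_small_errors (hx : IsDistributedSA h a τ x M)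
    (hL : LipschitzWith L h) {f : BlockSpace d → BlockSpace d} {δ η : ℝ}
    (hmargin : ∀ (y ζ : ℕ → BlockSpace d) (a : ℕ → ℝ), (∀ n, 0 ≤ a n) → (∀ n, a n ≤ η) →
      ‖y 0‖ ≤ δ → (∀ n, ‖ζ n‖ ≤ η) →
      (∀ n, (∀ m ≤ n, ‖y m‖ ≤ 1) → ∃ e, ‖e‖ ≤ η ∧
        y (n + 1) = y n + a n • (f (y n) + e) + (ζ (n + 1) - ζ n)) → ∀ n, ‖y n‖ ≤ 1)
    {ε : ℝ} (hε : 0 ≤ ε) (hε1 : ε ≤ 1) (hεδ : ε ≤ δ) (hεη : D * ε ≤ η)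
    (hεη' : errorFactor D L ‖h 0‖ * ε ≤ η) (hc : 1 ≤ c)
    (hscale : ∀ y, ‖y‖ ≤ 1 → ‖c⁻¹ • h (c • y) - f y‖ ≤ ε)
    (ha : ∀ n, 1 ≤ n → 0 ≤ a n) {n₀ : ℕ} (hn₀ : 1 ≤ n₀) (ha' : ∀ n, n₀ ≤ n → a n ≤ η)
    (hage : ∀ n, n₀ ≤ n → ∀ i j, τ i j n ω < n ∧ ∑ m ∈ Finset.Ico (n - τ i j n ω) n, a m ≤ ε)
    (hinit : ω ∈ stayEvent x (ε * c) n₀)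
    (hnoise : ∀ i n, ‖∑ m ∈ Finset.range n, stoppedNoise a x M c i (n₀ + m) ω‖ ≤ ε) (n : ℕ) :
    ‖x n ω‖ ≤ c := by
  have hc0 : 0 < c := by linarith
  have hζ : ∀ n, ‖noiseSum a x M c n₀ n ω‖ ≤ D * ε := fun n =>
    norm_le_card_mul_of_forall_norm_le hε fun i => hnoise i n
  have hinit' : ∀ m ≤ n₀, ‖x m ω‖ ≤ c := fun m hm =>
    (hinit m hm).trans (mul_le_of_le_one_left hc0.le hε1)
  have hiff : ∀ n, ‖c⁻¹ • x n ω‖ ≤ 1 ↔ ‖x n ω‖ ≤ c := fun n => by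
    rw [norm_smul, Real.norm_of_nonneg (by positivity), inv_mul_le_iff₀ hc0, mul_one]
  have key := hmargin (fun n => c⁻¹ • x (n₀ + n) ω) (fun n => noiseSum a x M c n₀ n ω)
    (fun n => a (n₀ + n)) (fun n => ha _ (by omega)) (fun n => ha' _ (by omega)) ?_
    (fun n => (hζ n).trans hεη) ?_
  · rcases le_total n n₀ with hn | hn
    · exact hinit' n hn
    · obtain ⟨k, rfl⟩ := Nat.exists_eq_add_of_le hn
      exact (hiff _).1 (key k)
  · rw [norm_smul, Real.norm_of_nonneg (by positivity), inv_mul_le_iff₀ hc0, mul_comm]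
    exact (hinit n₀ le_rfl).trans (by gcongr)
  intro n hn
  have hstay : ω ∈ stayEvent x c (n₀ + n) := fun m hm => by
    rcases le_total m n₀ with h | h
    · exact hinit' m h
    · obtain ⟨k, rfl⟩ := Nat.exists_eq_add_of_le h
      exact (hiff _).1 (hn k (by omega))
  set N := n₀ + n with hN
  -- The perturbation is the whole drift discrepancy. It splits into the age displacement, passed
  -- through the Lipschitz bound, and the scaling error; every block has its own aged state.
  refine ⟨c⁻¹ • agedDrift h x τ N ω - f (c⁻¹ • x N ω), ?_, ?_⟩
  · refine le_trans ?_ hεη'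
    rw [errorFactor, mul_assoc]
    refine norm_le_card_mul_of_forall_norm_le (by positivity) fun i => ?_
    have h1 : ‖agedState x τ i N ω - x N ω‖ ≤
        D * ((D * (‖h 0‖ + L * D) * ε + 2 * (D * ε) + 2 * ε) * c) := by
      refine norm_le_card_mul_of_forall_norm_le (by positivity) fun j => ?_
      obtain ⟨hlt, hsum⟩ := hage N (by omega) i j
      have h2 := hx.norm_sub_aged_le hL hc hn₀ ha hζ hε hinit (n := N) (m := N - τ i j N ω)
        (by omega) (by omega) (by omega) hsum hstay
      rw [norm_sub_rev] at h2
      exact (PiLp.norm_apply_le (x (N - τ i j N ω) ω - x N ω) j).trans h2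
    have h2 : ‖c⁻¹ • h (agedState x τ i N ω) - c⁻¹ • h (x N ω)‖ ≤
        L * (D * (D * (‖h 0‖ + L * D) * ε + 2 * (D * ε) + 2 * ε)) := by
      rw [← smul_sub, norm_smul, Real.norm_of_nonneg (by positivity), inv_mul_le_iff₀ hc0]
      refine (hL.norm_sub_le _ _).trans ?_
      calc (L : ℝ) * ‖agedState x τ i N ω - x N ω‖
          ≤ L * (D * ((D * (‖h 0‖ + L * D) * ε + 2 * (D * ε) + 2 * ε) * c)) := by gcongr
        _ = _ := by ring
    have h3 := hscale (c⁻¹ • x N ω) ((hiff N).2 (hstay N le_rfl))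
    rw [smul_inv_smul₀ hc0.ne'] at h3
    have h4 := norm_sub_le_norm_sub_add_norm_sub (c⁻¹ • h (agedState x τ i N ω))
      (c⁻¹ • h (x N ω)) (f (c⁻¹ • x N ω))
    refine (PiLp.norm_apply_le (c⁻¹ • h (agedState x τ i N ω) - f (c⁻¹ • x N ω)) i).trans ?_
    linarith
  · have hstep := hx.step_of_mem_stayEvent hc0.ne' hn₀ n hstay
    rw [add_sub_cancel, ← add_assoc, hstep, smul_add, smul_add, inv_smul_smul₀ hc0.ne',
      smul_comm c⁻¹ (a _)]

end Path

/-! ### Exceptional events and the conclusion -/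

theorem tendsto_measure_zero_of_antitone_of_ae_exists_notMem {Ω : Type*} [MeasurableSpace Ω]
    {P : Measure Ω} [IsFiniteMeasure P] {s : ℕ → Set Ω} (hs : ∀ n, MeasurableSet (s n))
    (hanti : Antitone s) (hex : ∀ᵐ ω ∂P, ∃ n, ω ∉ s n) :
    Tendsto (fun n => P (s n)) atTop (𝓝 0) := by
  have h := tendsto_measure_iInter_atTop (μ := P) (fun n => (hs n).nullMeasurableSet) hanti
    ⟨0, measure_ne_top _ _⟩
  have h0 : P (⋂ n, s n) = 0 :=
    measure_mono_null (fun ω hω => fun ⟨n, hn⟩ => hn (Set.mem_iInter.1 hω n)) (ae_iff.1 hex)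
  rwa [h0] at h

theorem IsAoIProcess.measurableSet_window {Ω : Type*} [MeasurableSpace Ω] {D : ℕ}
    {τ : Fin D → Fin D → ℕ → Ω → ℕ} (hτ : ∀ i j, IsAoIProcess (τ i j)) (a : ℕ → ℝ) (ε : ℝ)
    {n₀ : ℕ} (hn₀ : 1 ≤ n₀) :
    MeasurableSet {ω | ∀ n, n₀ ≤ n → ∀ i j,
      τ i j n ω < n ∧ ∑ m ∈ Finset.Ico (n - τ i j n ω) n, a m ≤ ε} := by
  have : {ω | ∀ n, n₀ ≤ n → ∀ i j,
      τ i j n ω < n ∧ ∑ m ∈ Finset.Ico (n - τ i j n ω) n, a m ≤ ε} =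
      ⋂ n ∈ Set.Ici n₀, ⋂ i, ⋂ j, τ i j n ⁻¹' {t | t < n ∧ ∑ m ∈ Finset.Ico (n - t) n, a m ≤ ε} := by
    ext ω; simp
  rw [this]
  exact MeasurableSet.biInter (Set.to_countable _) fun n hn => MeasurableSet.iInter fun i =>
    MeasurableSet.iInter fun j => (hτ i j).measurable n (hn₀.trans hn) .of_discrete

theorem mainTheorem6 {Ω : Type*} [MeasurableSpace Ω] (P : Measure Ω) [IsProbabilityMeasure P]
    {D : ℕ} (d : Fin D → ℕ) (h : BlockSpace d → BlockSpace d) (a : ℕ → ℝ)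
    (τ : Fin D → Fin D → ℕ → Ω → ℕ) (x M : ℕ → Ω → BlockSpace d)
    -- the iteration and its square integrable initial values
    (hx : IsDistributedSA h a τ x M)
    (hx0 : Measurable (x 0)) (hx0_sq : MemLp (x 0) 2 P)
    (hx1 : Measurable (x 1)) (hx1_sq : MemLp (x 1) 2 P)
    -- Lipschitz drift
    (L : ℝ≥0) (hL : LipschitzWith L h)
    -- martingale difference noise
    (K : ℝ) (hK : 0 < K) (hM : IsNoise P τ x M K)
    -- age of information with a uniform moment bound
    (hτ : ∀ i j, IsAoIProcess (τ i j))
    {Ω' : Type*} [MeasurableSpace Ω'] (Q : Measure Ω') [IsProbabilityMeasure Q]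
    (τbar : Ω' → ℝ) (hτbar : Measurable τbar) (hτbar_nonneg : ∀ ω, 0 ≤ τbar ω)
    (p : ℝ) (hp : 0 < p) (hτbar_moment : Integrable (fun ω => τbar ω ^ p) Q)
    (hdom : ∀ i j, ∀ n : ℕ, 1 ≤ n → StochDominated P (fun ω => (τ i j n ω : ℝ)) Q τbar)
    -- stepsize
    (ha : IsStepsize p a)
    -- scaling limit along some sequence
    (hscale : HasStableScalingLimit h) :
    ∀ᵐ ω ∂P, BddAbove (Set.range fun n => ‖x n ω‖) := by
  obtain ⟨c, f, hc, hcmono, hctop, hlim, -, hstable⟩ := hscale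
  obtain ⟨δ, hδ, η, hη, hmargin⟩ :=
    hstable.exists_perturbed_euler_margin (hL.scaling_limit hc hlim)
  have hC : 0 ≤ errorFactor D L ‖h 0‖ := by unfold errorFactor; positivity
  obtain ⟨ε, hε, hε1, hεδ, hεη, hεη'⟩ : ∃ ε : ℝ, 0 < ε ∧ ε ≤ 1 ∧ ε ≤ δ ∧ D * ε ≤ η ∧
      errorFactor D L ‖h 0‖ * ε ≤ η := by
    set B := errorFactor D L ‖h 0‖ + D + 1
    have hB : 0 < B := by positivity
    refine ⟨min (min 1 δ) (η / B), by positivity, (min_le_left _ _).trans (min_le_left _ _),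
      (min_le_left _ _).trans (min_le_right _ _), ?_, ?_⟩
    all_goals
      refine le_trans (mul_le_mul (b := B) ?_ (min_le_right _ _) (by positivity) hB.le)
        (mul_div_cancel₀ η hB.ne').le
      simp only [B]
      linarith [(Nat.cast_nonneg D : (0 : ℝ) ≤ D)]
  have hxm : ∀ n k, k ≤ n → Measurable (x k) := fun n k hk =>
    (measurable_iterate_history hL.continuous.measurable hx n k hk).mono
      (history_le hx0 hx1 hM hτ n) le_rfl
  -- the three exceptional events
  set A : ℕ → Set Ω := fun k => {ω | ∀ n, k + 1 ≤ n → ∀ i j,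
      τ i j n ω < n ∧ ∑ m ∈ Finset.Ico (n - τ i j n ω) n, a m ≤ ε}ᶜ with hA
  -- The start time is `n₀ = k + 1 ≥ 1` and the scale is `c l`; the bound `v k` for these events
  -- does not depend on `l`.
  set S : ℕ → ℕ → Fin D → Set Ω := fun k l i =>
    {ω | ∃ n, ε ≤ ‖∑ m ∈ Finset.range n, stoppedNoise a x M (c l) i (k + 1 + m) ω‖} with hS
  set I : ℕ → ℕ → Set Ω := fun k l => (stayEvent x (ε * c l) (k + 1))ᶜ with hI
  set v : ℕ → ℝ := fun k => (∑' n, K ^ 2 * (1 + D) * a (k + 1 + n) ^ 2) / ε ^ 2 with hv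
  have hAlim : Tendsto (fun k => P (A k)) atTop (𝓝 0) := by
    refine tendsto_measure_zero_of_antitone_of_ae_exists_notMem
      (fun k => (IsAoIProcess.measurableSet_window hτ a ε (by omega)).compl)
      (fun k l hkl => Set.compl_subset_compl.2 fun ω hω n hn => hω n (by omega)) ?_
    have hall : ∀ᵐ ω ∂P, ∀ i j, ∀ᶠ n : ℕ in atTop,
        τ i j n ω < n ∧ ∑ m ∈ Finset.Ico (n - τ i j n ω) n, a m ≤ ε :=
      ae_all_iff.2 fun i => ae_all_iff.2 fun j => (hτ i j).ae_eventually_sum_stepsize_le hτbar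
        hτbar_nonneg hp hτbar_moment (hdom i j) ha hε
    filter_upwards [hall] with ω hω
    have hω' := eventually_all.2 fun i => eventually_all.2 (hω i)
    obtain ⟨k, hk⟩ := eventually_atTop.1 hω'
    exact ⟨k, fun hmem => hmem fun n hn => hk n (by omega)⟩
  have hIlim : ∀ k, Tendsto (fun l => P (I k l)) atTop (𝓝 0) := fun k => by
    refine tendsto_measure_zero_of_antitone_of_ae_exists_notMem
      (fun l => (measurableSet_stayEvent (hxm (k + 1)) _).compl)
      (fun l l' hl => Set.compl_subset_compl.2 fun ω hω m hm => (hω m hm).trans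
        (mul_le_mul_of_nonneg_left (hcmono hl) hε.le)) (ae_of_all _ fun ω => ?_)
    have : ∀ᶠ l in atTop, ∀ m ∈ Set.Iic (k + 1), ‖x m ω‖ ≤ ε * c l :=
      (eventually_all_finite (Set.finite_Iic _)).2 fun m _ =>
        (hctop.const_mul_atTop hε).eventually_ge_atTop _
    obtain ⟨l, hl⟩ := this.exists
    exact ⟨l, fun hmem => hmem hl⟩
  have hvlim : Tendsto (fun k => ∑ _i : Fin D, ENNReal.ofReal (v k)) atTop (𝓝 0) := by
    have h1 : Tendsto v atTop (𝓝 0) := by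
      have h2 := (tendsto_add_atTop_iff_nat 1).2
        (tendsto_sum_nat_add fun n => K ^ 2 * (1 + D) * a n ^ 2)
      simpa [hv, add_comm, add_left_comm] using h2.div_const (ε ^ 2)
    have h3 := ENNReal.tendsto_ofReal h1
    rw [ENNReal.ofReal_zero] at h3
    simpa using tendsto_finsetSum (Finset.univ : Finset (Fin D)) fun _ _ => h3
  have hSle : ∀ k l i, P (S k l i) ≤ ENNReal.ofReal (v k) := fun k l i =>
    measure_exists_stoppedNoise_ge_le hL.continuous.measurable hx hx0 hx1 hM hτ ha.summable_sq
      (hc l) (by omega) hε i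
  have hsub : ∀ᶠ k in atTop, ∀ᶠ l in atTop,
      {ω | ¬ BddAbove (Set.range fun n => ‖x n ω‖)} ⊆ (A k ∪ ⋃ i, S k l i) ∪ I k l := by
    obtain ⟨k₀, hk₀⟩ := eventually_atTop.1 (ha.tendsto_zero.eventually_le_const hη)
    filter_upwards [eventually_ge_atTop k₀] with k hk
    filter_upwards [hL.eventually_norm_rescaled_sub_limit_le hc hlim hε] with l hl ω hω
    by_contra hcon
    simp only [Set.mem_union, not_or, Set.mem_iUnion, not_exists, hA, hI, Set.mem_compl_iff,
      not_not] at hcon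
    obtain ⟨⟨h1, h2⟩, h3⟩ := hcon
    refine hω ⟨c l, ?_⟩
    rintro _ ⟨n, rfl⟩
    exact hx.norm_le_of_small_errors hL hmargin hε.le hε1 hεδ hεη hεη' (hc l) hl
      (fun n hn => (ha.pos hn).le) (by omega) (fun n hn => hk₀ n (by omega)) h1 h3
      (fun i n => (not_le.1 fun hle => h2 i ⟨n, hle⟩).le) n
  -- For fixed `k` let `l → ∞`: only `P (I k l)` depends on `l` in the bound, and it vanishes.
  have hle : ∀ᶠ k in atTop, P {ω | ¬ BddAbove (Set.range fun n => ‖x n ω‖)} ≤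
      P (A k) + ∑ _i : Fin D, ENNReal.ofReal (v k) := by
    filter_upwards [hsub] with k hk
    have hlim' := (hIlim k).const_add (P (A k) + ∑ _i : Fin D, ENNReal.ofReal (v k))
    rw [add_zero] at hlim'
    refine ge_of_tendsto hlim' ?_
    filter_upwards [hk] with l hl
    refine (measure_mono hl).trans ((measure_union_le _ _).trans
      (add_le_add ((measure_union_le _ _).trans (add_le_add le_rfl ?_)) le_rfl))
    exact (measure_iUnion_fintype_le P _).trans (Finset.sum_le_sum fun i _ => hSle k l i)
  rw [ae_iff]
  have hsum := hAlim.add hvlim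
  rw [add_zero] at hsum
  exact le_antisymm (ge_of_tendsto hsum hle) zero_le
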